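/- \textbf{Conventions.} Modules are right modules. Let $R$ be an integral domain with field of fractions $\mathbb F$. A cellular algebra over $R$ is a unital $R$-algebra $A$ with an $R$-linear involutive anti-automorphism $*$, a finite poset $(\widehat A,\unrhd)$, finite non-empty index sets attached to the $\lambda\in\widehat A$, and an $R$-basis $c^\lambda_{\mathsf s\mathsf t}$ such that $c^\lambda_{\mathsf s\mathsf t}a\equiv\sum_{\mathsf v} r(a;\mathsf t,\mathsf v)c^\lambda_{\mathsf s\mathsf v}$ and $(c^\lambda_{\mathsf s\mathsf t})^*\equiv c^\lambda_{\mathsf t\mathsf s}$ modulo $A^{\rhd\lambda}=\mathrm{span}\{c^\mu_{\mathsf u\mathsf v}:\mu\rhd\lambda\}$; put $A^{\unrhd\lambda}=\mathrm{span}\{c^\mu_{\mathsf u\mathsf v}:\mu\unrhd\lambda\}$. The cell module $\Delta(\lambda)$ is free over $R$ with basis $c_{\mathsf t}$ and action $c_{\mathsf t}a=\sum_{\mathsf v} r(a;\mathsf t,\mathsf v)c_{\mathsf v}$. \textbf{The tower.} Let $A_0\subseteq A_1\subseteq\cdots$ be an increasing sequence of cellular $R$-algebras with unital inclusions and consistent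 involutions, with cell modules $\Delta_r(\lambda)$, $\lambda\in\widehat A_r$, such that $A_0=R$, every $\Delta_r(\lambda)$ is cyclic, and every $A_r^{\mathbb F}=A_r\otimes_R\mathbb F$ is split semisimple. Fix generators $\delta(\lambda)$ of the $\Delta_r(\lambda)$, bimodule isomorphisms $\alpha_\lambda:A_r^{\unrhd\lambda}/A_r^{\rhd\lambda}\to\Delta_r(\lambda)^*\otimes_R\Delta_r(\lambda)$, and elements $m_\lambda=m_\lambda^*\in A_r^{\unrhd\lambda}$ with $\alpha_\lambda(m_\lambda+A_r^{\rhd\lambda})=\delta(\lambda)^*\otimes\delta(\lambda)$. Suppose that the restriction of every $\Delta_{r+1}(\mu)$ to $A_r$ has a filtration $0=M_0\subseteq\cdots\subseteq M_n$ with isomorphisms $\Delta_r(\lambda^{(i)})\cong M_i/M_{i-1}$ and $\lambda^{(1)}\rhd\lambda^{(2)}\rhd\cdots\rhd\lambda^{(n)}$, and fix one. The branching diagram has an edge $\lambda\to\mu$ if $\lambda$ is one of these $\lambda^{(i)}$. Choose $d_{\lambda^{(i)}\to\mu}\in A_{r+1}$ such that the isomorphism maps $\delta(\lambda^{(i)})$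 to $\delta(\mu)d_{\lambda^{(i)}\to\mu}+M_{i-1}$, and suppose that for each edge there is $u_{\lambda\to\mu}\in A_{r+1}$ with $m_\mu d_{\lambda\to\mu}=(u_{\lambda\to\mu})^*m_\lambda$. \textbf{Tableaux.} Let $\mathrm{Std}_{s,r}(\nu\setminus\lambda)$ be the set of paths $\mathsf t$ in the branching diagram from $\lambda=\mathsf t(s)\in\widehat A_s$ to $\nu=\mathsf t(r)\in\widehat A_r$, and $\mathrm{Std}_r(\nu)$ the set of paths from $\varnothing$, the only element of $\widehat A_0$, to $\nu$. Put $\mathsf s\unrhd\mathsf t$ if $\mathsf s(j)\unrhd\mathsf t(j)$ for all $j$ (dominance), and write $\circ$ for concatenation. For $\mathsf t\in\mathrm{Std}_r(\nu)$ let $d_{\mathsf t}=d_{\mathsf t(r-1)\to\mathsf t(r)}\cdots d_{\mathsf t(0)\to\mathsf t(1)}$, and let $m^\nu_{\mathsf t}=m_\nu d_{\mathsf t}+A_r^{\rhd\nu}\in\Delta_r(\nu)$, where $m_\nu+A_r^{\rhd\nu}$ is identified with $\delta(\nu)$, so that $m^\nu_{\mathsf t}=\delta(\nu)d_{\mathsf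 t}$. Let $\Delta_r^{\mathbb F}(\nu)=\Delta_r(\nu)\otimes_R\mathbb F$, let $z^r_\nu$ be the minimal central idempotent of $A_r^{\mathbb F}$ acting as the identity on $\Delta_r^{\mathbb F}(\nu)$, and $F_{\mathsf t}=\prod_{i=1}^{r}z^i_{\mathsf t(i)}$. \textbf{Statement.} Let $0\le s\le r$, $\lambda\in\widehat A_s$, $\nu\in\widehat A_r$. Let $A_r\cap A_s'$ be the commutant of $A_s$ in $A_r$, and likewise $A_r^{\mathbb F}\cap(A_s^{\mathbb F})'$. Then $\mathrm{Std}_s(\lambda)$ has a maximal element in the dominance order. For maximal $\mathsf t^\lambda\in\mathrm{Std}_s(\lambda)$ put $$\Delta(\nu;\rhd\lambda)=\mathrm{span}_R\{m^\nu_{\mathsf t}:\mathsf t\in\mathrm{Std}_r(\nu),\ \mathsf t(s)\rhd\lambda\},\qquad \Delta(\nu;\mathsf t^\lambda)=\mathrm{span}_R\{m^\nu_{\mathsf t^\lambda\circ\mathsf p}:\mathsf p\in\mathrm{Std}_{s,r}(\nu\setminus\lambda)\}.$$ (0) $\Delta(\nu;\rhd\lambda)$ and $\Delta(\nu;\mathsf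 t^\lambda)+\Delta(\nu;\rhd\lambda)$ are $A_r\cap A_s'$-submodules of $\Delta_r(\nu)$. Hence $\Delta(\nu\setminus\lambda):=(\Delta(\nu;\mathsf t^\lambda)+\Delta(\nu;\rhd\lambda))/\Delta(\nu;\rhd\lambda)$ is an $A_r\cap A_s'$-module. (1) Up to isomorphism of $A_r\cap A_s'$-modules, $\Delta(\nu\setminus\lambda)$ does not depend on the choice of the maximal element $\mathsf t^\lambda$. (2) $\Delta(\nu;\mathsf t^\lambda)F_{\mathsf t^\lambda}\subseteq\Delta_r^{\mathbb F}(\nu)$ is an $A_r\cap A_s'$-submodule, and $\Delta(\nu\setminus\lambda)\cong\Delta(\nu;\mathsf t^\lambda)F_{\mathsf t^\lambda}$ as $A_r\cap A_s'$-modules. (3) For every $\mathsf s\in\mathrm{Std}_s(\lambda)$, $\Delta_r^{\mathbb F}(\nu)F_{\mathsf s}$ is an $A_r^{\mathbb F}\cap(A_s^{\mathbb F})'$-submodule of $\Delta_r^{\mathbb F}(\nu)$, and $\Delta(\nu\setminus\lambda)\otimes_R\mathbb F\cong\Delta_r^{\mathbb F}(\nu)F_{\mathsf s}$ as $A_r^{\mathbb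 F}\cap(A_s^{\mathbb F})'$-modules. (4) The classes $m^\nu_{\mathsf t^\lambda\circ\mathsf p}+\Delta(\nu;\rhd\lambda)$, for $\mathsf p\in\mathrm{Std}_{s,r}(\nu\setminus\lambda)$, form an $R$-basis of $\Delta(\nu\setminus\lambda)$. (5) Suppose moreover that each $A_r$ has an $R$-algebra automorphism $f_r$ with $f_r^2=1$ such that $f_r(A_{r-s})$ commutes with $A_s$ whenever $s\le r$. Then the $A_{r-s}$-module obtained from $\Delta(\nu\setminus\lambda)$ through the homomorphism $f_r\circ f_{r-s}:A_{r-s}\to A_r\cap A_s'$ (the skew cell module) is, up to isomorphism, independent of the choice of $\mathsf t^\lambda$. -/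

import Mathlib

open scoped TensorProduct
open MulOpposite (op unop)

noncomputable section

namespace DiagramAlgebra

universe u v w x

/-! ### Right modules

A right `A`-module is a module over `Aᵐᵒᵖ`; the product `y · a` is `op a • y`. -/

/-- The restriction of a right `B`-module `N` along a homomorphism of algebras `f : A → B`. -/
def Res {R : Type*} {A : Type*} {B : Type*} [CommRing R] [Ring A] [Algebra R A] [Ring B]
    [Algebra R B] (_f : A →ₐ[R] B) (N : Type*) : Type _ := N

section Res

variable {R : Type*} {A : Type*} {B : Type*} [CommRing R] [Ring A] [Algebra R A] [Ring B]
  [Algebra R B] (f : A →ₐ[R] B) (N : Type*) [AddCommGroup N]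

instance : AddCommGroup (Res f N) := inferInstanceAs (AddCommGroup N)

instance {K : Type*} [CommRing K] [Module K N] : Module K (Res f N) :=
  inferInstanceAs (Module K N)

instance [Module Bᵐᵒᵖ N] : Module Aᵐᵒᵖ (Res f N) := Module.compHom N f.toRingHom.op

theorem res_smul [Module Bᵐᵒᵖ N] (a : A) (y : N) :
    (show N from op a • (show Res f N from y)) = op (f a) • y := rfl

instance [Module R N] [Module Bᵐᵒᵖ N] [IsScalarTower R Bᵐᵒᵖ N] :
    IsScalarTower R Aᵐᵒᵖ (Res f N) where
  smul_assoc c a y := by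
    have h : op (f (unop (c • a))) = c • op (f (unop a)) := by
      rw [MulOpposite.unop_smul, map_smul, MulOpposite.op_smul]
    change op (f (unop (c • a))) • (show N from y) = c • (op (f (unop a)) • (show N from y))
    rw [h, smul_assoc]

end Res

/-- A `K`-submodule `S` of a right `A`-module is closed under the action of `A`. -/
def IsStable (A : Type*) {K N : Type*} [Ring A] [CommRing K] [AddCommGroup N] [Module K N]
    [Module Aᵐᵒᵖ N] (S : Submodule K N) : Prop :=
  ∀ (a : A), ∀ y ∈ S, op a • y ∈ S

/-- A `K`-submodule that is closed under the action of `A`, as a submodule over `A`. -/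
def IsStable.sub {A K N : Type*} [Ring A] [CommRing K] [AddCommGroup N] [Module K N]
    [Module Aᵐᵒᵖ N] {S : Submodule K N} (h : IsStable A S) : Submodule Aᵐᵒᵖ N where
  carrier := S
  add_mem' := S.add_mem
  zero_mem' := S.zero_mem
  smul_mem' a y hy := h (unop a) y hy

/-! ### Extension of scalars for right modules -/

section BaseChange

variable (R F A M : Type*) [CommRing R] [CommRing F] [Algebra R F] [Ring A] [Algebra R A]
  [AddCommGroup M] [Module R M] [Module Aᵐᵒᵖ M] [IsScalarTower R Aᵐᵒᵖ M]

/-- The right action of `F ⊗ A` on `F ⊗ M`, in which `(e ⊗ y) · (c ⊗ a) = ec ⊗ (y · a)`. -/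
def extAct : F ⊗[R] A →ₐ[F] (Module.End F (F ⊗[R] M))ᵐᵒᵖ :=
  Algebra.TensorProduct.lift (Algebra.ofId F _)
    (AlgHom.opComm.symm ((Module.End.baseChangeHom R F M).comp (Algebra.lsmul R R M)))
    (fun c _ => by rw [Algebra.ofId_apply]; exact Algebra.commute_algebraMap_left c _)

instance extModule : Module (F ⊗[R] A)ᵐᵒᵖ (F ⊗[R] M) :=
  Module.compHom (F ⊗[R] M) (AlgHom.opComm (extAct R F A M)).toRingHom

theorem op_tmul_smul (c e : F) (a : A) (y : M) :
    op (c ⊗ₜ[R] a) • (e ⊗ₜ[R] y) = (e * c) ⊗ₜ[R] (op a • y) := by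
  change (unop (extAct R F A M (c ⊗ₜ[R] a))) (e ⊗ₜ[R] y) = _
  rw [extAct, Algebra.TensorProduct.lift_tmul, MulOpposite.unop_mul, Algebra.ofId_apply,
    MulOpposite.algebraMap_apply, MulOpposite.unop_op, Module.End.mul_apply,
    Module.algebraMap_end_apply, TensorProduct.smul_tmul', smul_eq_mul, mul_comm]
  rfl

instance : IsScalarTower F (F ⊗[R] A)ᵐᵒᵖ (F ⊗[R] M) where
  smul_assoc c a y := by
    change (AlgHom.opComm (extAct R F A M)) (c • a) y
      = c • (AlgHom.opComm (extAct R F A M)) a y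
    rw [map_smul, LinearMap.smul_apply]

instance : IsScalarTower R (F ⊗[R] A)ᵐᵒᵖ (F ⊗[R] M) where
  smul_assoc c a y := by
    rw [← IsScalarTower.algebraMap_smul F c a, smul_assoc, IsScalarTower.algebraMap_smul]

end BaseChange

/-! ### Cellular algebras and their cell modules -/

/-- A cell datum for the `R`-algebra `A`: an involution `inv`, a finite partially ordered set
`Idx`, finite non-empty index sets `Tab l`, and a basis `c_{st}^l` of `A`, written
`basis ⟨l, s, t⟩`, subject to the two axioms of a cellular basis. The relation `l ⊵ k` of the
cellular order is `k ≤ l`. -/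
structure CellDatum (R : Type u) (A : Type v) [CommRing R] [Ring A] [Algebra R A] where
  inv : A →ₗ[R] A
  inv_mul : ∀ a b, inv (a * b) = inv b * inv a
  inv_inv : ∀ a, inv (inv a) = a
  Idx : Type w
  [order : PartialOrder Idx]
  [finiteIdx : Finite Idx]
  Tab : Idx → Type w
  [fintypeTab : ∀ l, Fintype (Tab l)]
  [nonemptyTab : ∀ l, Nonempty (Tab l)]
  basis : Module.Basis (Σ l, Tab l × Tab l) R A
  basis_mul : ∀ (l : Idx) (t : Tab l) (a : A), ∃ c : Tab l → R, ∀ s : Tab l,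
    basis ⟨l, s, t⟩ * a - ∑ z, c z • basis ⟨l, s, z⟩ ∈
      Submodule.span R {y | ∃ (k : Idx) (p q : Tab k), l < k ∧ y = basis ⟨k, p, q⟩}
  inv_basis : ∀ (l : Idx) (s t : Tab l),
    inv (basis ⟨l, s, t⟩) - basis ⟨l, t, s⟩ ∈
      Submodule.span R {y | ∃ (k : Idx) (p q : Tab k), l < k ∧ y = basis ⟨k, p, q⟩}

attribute [instance] CellDatum.order CellDatum.finiteIdx CellDatum.fintypeTab
  CellDatum.nonemptyTab

namespace CellDatum

variable {R : Type u} {A : Type v} [CommRing R] [Ring A] [Algebra R A] (D : CellDatum.{u, v, w} R A)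

/-- `A^{▷ l}`. -/
def above (l : D.Idx) : Submodule R A :=
  Submodule.span R {y | ∃ (k : D.Idx) (p q : D.Tab k), l < k ∧ y = D.basis ⟨k, p, q⟩}

/-- `A^{⊵ l}`. -/
def aboveEq (l : D.Idx) : Submodule R A :=
  Submodule.span R {y | ∃ (k : D.Idx) (p q : D.Tab k), l ≤ k ∧ y = D.basis ⟨k, p, q⟩}

/-- The coefficient `r(a; t, z)` in `c_{st} a ≡ ∑ z, r(a; t, z) c_{sz}`. It does not depend on
`s`, see `coeff_eq`. -/
def coeff (l : D.Idx) (a : A) (t z : D.Tab l) : R := D.basis.repr (D.basis ⟨l, t, t⟩ * a) ⟨l, t, z⟩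

theorem repr_above {l : D.Idx} {y : A} (hy : y ∈ D.above l) (s z : D.Tab l) :
    D.basis.repr y ⟨l, s, z⟩ = 0 := by
  classical
  induction hy using Submodule.span_induction with
  | mem y h =>
    obtain ⟨k, p, q, hk, rfl⟩ := h
    rw [D.basis.repr_self, Finsupp.single_apply, if_neg]
    intro e
    have := congrArg Sigma.fst e
    exact hk.ne this.symm
  | zero => simp
  | add x y _ _ hx hy => simp [hx, hy]
  | smul c x _ hx => simp [hx]

theorem repr_sum (l : D.Idx) (c : D.Tab l → R) (s z : D.Tab l) :
    D.basis.repr (∑ q, c q • D.basis ⟨l, s, q⟩) ⟨l, s, z⟩ = c z := by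
  classical
  simp only [map_sum, map_smul, Module.Basis.repr_self, Finsupp.coe_finsetSum, Finset.sum_apply,
    Finsupp.smul_apply, Finsupp.single_apply, smul_eq_mul]
  rw [Finset.sum_eq_single z]
  · simp
  · intro q _ hq
    rw [if_neg, mul_zero]
    intro e
    simp at e
    exact hq e
  · simp

theorem coeff_eq (l : D.Idx) (a : A) (t z s : D.Tab l) :
    D.basis.repr (D.basis ⟨l, s, t⟩ * a) ⟨l, s, z⟩ = D.coeff l a t z := by
  obtain ⟨c, hc⟩ := D.basis_mul l t a
  have key : ∀ s, D.basis.repr (D.basis ⟨l, s, t⟩ * a) ⟨l, s, z⟩ = c z := fun s => by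
    have h := D.repr_above (hc s) s z
    rw [map_sub, Finsupp.sub_apply, D.repr_sum] at h
    exact sub_eq_zero.mp h
  rw [key s, coeff, key t]

theorem basis_mul_coeff (l : D.Idx) (a : A) (s t : D.Tab l) :
    D.basis ⟨l, s, t⟩ * a - ∑ z, D.coeff l a t z • D.basis ⟨l, s, z⟩ ∈ D.above l := by
  obtain ⟨c, hc⟩ := D.basis_mul l t a
  have h : ∀ z, D.coeff l a t z = c z := fun z => by
    have h := D.repr_above (hc t) t z
    rw [map_sub, Finsupp.sub_apply, D.repr_sum] at h
    exact sub_eq_zero.mp h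
  simp only [h]
  exact hc s

theorem above_mul {l : D.Idx} {y : A} (hy : y ∈ D.above l) (a : A) : y * a ∈ D.above l := by
  induction hy using Submodule.span_induction with
  | mem y h =>
    obtain ⟨k, p, q, hk, rfl⟩ := h
    have h1 := D.basis_mul_coeff k a p q
    have h2 : D.above k ≤ D.above l := Submodule.span_mono (by
      rintro _ ⟨k', p, q, hk', rfl⟩
      exact ⟨k', p, q, hk.trans hk', rfl⟩)
    have h3 : ∑ z, D.coeff k a q z • D.basis ⟨k, p, z⟩ ∈ D.above l :=
      Submodule.sum_mem _ fun z _ =>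
        Submodule.smul_mem _ _ (Submodule.subset_span ⟨k, p, z, hk, rfl⟩)
    have h4 := Submodule.add_mem _ (h2 h1) h3
    rwa [sub_add_cancel] at h4
  | zero => simp
  | add x y _ _ hx hy => rw [add_mul]; exact Submodule.add_mem _ hx hy
  | smul c x _ hx => rw [smul_mul_assoc]; exact Submodule.smul_mem _ _ hx

theorem coeff_mul (l : D.Idx) (a b : A) (t z : D.Tab l) :
    D.coeff l (a * b) t z = ∑ q, D.coeff l a t q * D.coeff l b q z := by
  have h := D.repr_above (D.above_mul (D.basis_mul_coeff l a t t) b) t z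
  rw [sub_mul, map_sub, Finsupp.sub_apply, sub_eq_zero, mul_assoc, D.coeff_eq] at h
  rw [h, Finset.sum_mul]
  simp only [smul_mul_assoc, map_sum, map_smul, Finsupp.coe_finsetSum, Finset.sum_apply,
    Finsupp.smul_apply, smul_eq_mul, D.coeff_eq]

theorem coeff_one [DecidableEq (Σ l, D.Tab l × D.Tab l)] (l : D.Idx) (t z : D.Tab l) :
    D.coeff l 1 t z = if (⟨l, t, t⟩ : Σ l, D.Tab l × D.Tab l) = ⟨l, t, z⟩ then 1 else 0 := by
  rw [coeff, mul_one, D.basis.repr_self, Finsupp.single_apply]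

/-- The cell module `Δ(l)`: the free `R`-module with basis `c_t`, for `t` in `Tab l`. -/
def Cell (l : D.Idx) : Type _ := D.Tab l → R

instance (l : D.Idx) : AddCommGroup (D.Cell l) := inferInstanceAs (AddCommGroup (D.Tab l → R))

instance (l : D.Idx) : Module R (D.Cell l) := inferInstanceAs (Module R (D.Tab l → R))

/-- The right action `c_t · a = ∑ z, r(a; t, z) c_z` on the cell module. -/
def cellAct (l : D.Idx) (a : A) (y : D.Cell l) : D.Cell l := fun z => ∑ t, y t * D.coeff l a t z

instance (l : D.Idx) : Module Aᵐᵒᵖ (D.Cell l) where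
  smul a y := D.cellAct l (unop a) y
  one_smul y := by
    classical
    funext z
    change ∑ t, y t * D.coeff l 1 t z = y z
    simp only [D.coeff_one]
    rw [Finset.sum_eq_single z]
    · simp
    · intro q _ hq
      rw [if_neg, mul_zero]
      intro e
      simp at e
      exact hq e
    · simp
  mul_smul a b y := by
    funext z
    change ∑ t, y t * D.coeff l (unop b * unop a) t z
      = ∑ q, (∑ t, y t * D.coeff l (unop b) t q) * D.coeff l (unop a) q z
    simp only [D.coeff_mul, Finset.mul_sum, Finset.sum_mul]
    rw [Finset.sum_comm]
    simp only [mul_assoc]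
  smul_zero a := by
    funext z
    exact Finset.sum_eq_zero fun t _ => zero_mul _
  smul_add a x y := by
    funext z
    change ∑ t, (x t + y t) * _ = ∑ t, x t * _ + ∑ t, y t * _
    simp only [add_mul, Finset.sum_add_distrib]
  add_smul a b y := by
    funext z
    change ∑ t, y t * D.coeff l (unop a + unop b) t z
      = ∑ t, y t * D.coeff l (unop a) t z + ∑ t, y t * D.coeff l (unop b) t z
    simp only [coeff, mul_add, map_add, Finsupp.add_apply, Finset.sum_add_distrib]
  zero_smul y := by
    funext z
    change ∑ t, y t * D.coeff l 0 t z = 0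
    simp [coeff]

instance (l : D.Idx) : IsScalarTower R Aᵐᵒᵖ (D.Cell l) where
  smul_assoc c a y := by
    funext z
    change ∑ t, y t * D.coeff l (c • unop a) t z = c * ∑ t, y t * D.coeff l (unop a) t z
    simp only [coeff, mul_smul_comm, map_smul, Finsupp.smul_apply, smul_eq_mul, Finset.mul_sum]
    exact Finset.sum_congr rfl fun t _ => mul_left_comm _ _ _

/-- A cell filtration `0 = M_0 ⊆ M_1 ⊆ ⋯ ⊆ M_n = N` of a right `A`-module `N`, with isomorphisms
of the subquotient `M_{i+1} / M_i` with the cell module `Δ(label i)`. -/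
structure CellFiltration (N : Type*) [AddCommGroup N] [Module Aᵐᵒᵖ N] where
  n : ℕ
  M : Fin (n + 1) → Submodule Aᵐᵒᵖ N
  M_zero : M 0 = ⊥
  M_last : M (Fin.last n) = ⊤
  M_le : ∀ i : Fin n, M i.castSucc ≤ M i.succ
  label : Fin n → D.Idx
  iso : ∀ i : Fin n,
    D.Cell (label i) ≃ₗ[Aᵐᵒᵖ] M i.succ ⧸ (M i.castSucc).submoduleOf (M i.succ)

/-- The labels decrease strictly in the cellular order along the filtration. -/
def CellFiltration.OrderPreserving {D : CellDatum.{u, v, w} R A} {N : Type*} [AddCommGroup N]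
    [Module Aᵐᵒᵖ N] (f : D.CellFiltration N) : Prop :=
  ∀ i j : Fin f.n, (i : ℕ) + 1 = j → f.label j < f.label i

end CellDatum

/-- An algebra over a field is split semisimple if it is a finite product of full matrix algebras
over the field. -/
def IsSplitSemisimple (F A : Type*) [Field F] [Ring A] [Algebra F A] : Prop :=
  ∃ (n : ℕ) (d : Fin n → ℕ), (∀ i, d i ≠ 0) ∧
    Nonempty (A ≃ₐ[F] ((i : Fin n) → Matrix (Fin (d i)) (Fin (d i)) F))

def IsCentralIdempotent {A : Type*} [Ring A] (e : A) : Prop :=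
  e ∈ Subring.center A ∧ e * e = e

/-- A minimal element of the set of non-zero central idempotents, where `e ≤ f` means
`e * f = e`. -/
def IsMinimalCentralIdempotent {A : Type*} [Ring A] (e : A) : Prop :=
  IsCentralIdempotent e ∧ e ≠ 0 ∧
    ∀ f : A, IsCentralIdempotent f → f ≠ 0 → f * e = f → f = e

/-! ### Towers of diagram algebras -/

/-- An increasing sequence `A 0 ⊆ A 1 ⊆ ⋯` of cellular algebras over `R`, with unital inclusions
`ι` and consistent involutions. -/
structure CellularTower (R : Type u) (A : ℕ → Type v) [CommRing R] [∀ r, Ring (A r)]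
    [∀ r, Algebra R (A r)] where
  ι : ∀ {s r : ℕ}, s ≤ r → A s →ₐ[R] A r
  ι_refl : ∀ (r : ℕ) (a : A r), ι (le_refl r) a = a
  ι_trans : ∀ {q s r : ℕ} (h : q ≤ s) (h' : s ≤ r) (a : A q), ι h' (ι h a) = ι (h.trans h') a
  ι_injective : ∀ {s r : ℕ} (h : s ≤ r), Function.Injective (ι h)
  cell : ∀ r : ℕ, CellDatum.{u, v, w} R (A r)
  inv_ι : ∀ {s r : ℕ} (h : s ≤ r) (a : A s), (cell r).inv (ι h a) = ι h ((cell s).inv a)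

namespace CellularTower

variable {R : Type u} {A : ℕ → Type v} [CommRing R] [∀ r, Ring (A r)] [∀ r, Algebra R (A r)]
  (T : CellularTower.{u, v, w} R A)

abbrev Idx (r : ℕ) := (T.cell r).Idx

/-- `Δ_r(l)`. -/
abbrev Cell {r : ℕ} (l : T.Idx r) := (T.cell r).Cell l

/-- `A_r^{⊵ l} / A_r^{▷ l}`. -/
abbrev Layer {r : ℕ} (l : T.Idx r) :=
  (T.cell r).aboveEq l ⧸ ((T.cell r).above l).submoduleOf ((T.cell r).aboveEq l)

/-- The restriction of `Δ_{r+1}(n)` to `A_r`. -/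
abbrev ResCell {r : ℕ} (n : T.Idx (r + 1)) := Res (T.ι (Nat.le_succ r)) (T.Cell n)

end CellularTower

/-- A tower of diagram algebras over `R`, with `F` the field of fractions of `R`: an increasing
sequence of cellular algebras with `A 0 = R`, cyclic cell modules, `F ⊗ A r` split semisimple, and
restriction coherent, together with the choices on which the Murphy basis depends. These are the
generators `δ`, the isomorphisms `α`, the elements `m`, the order preserving cell filtrations and
the branching factors `d`.

In `α_act` the module `Δ(l)^* ⊗ Δ(l)` is `Δ(l) ⊗ Δ(l)`, and `a (p^* ⊗ q) b` is
`(p · a^*)^* ⊗ (q · b)`. -/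
structure DiagramTower (R : Type u) (F : Type x) (A : ℕ → Type v) [CommRing R] [Field F]
    [Algebra R F] [∀ r, Ring (A r)] [∀ r, Algebra R (A r)]
    extends CellularTower.{u, v, w} R A where
  zero_eq : Function.Bijective (algebraMap R (A 0))
  δ : ∀ {r : ℕ} (l : (cell r).Idx), (cell r).Cell l
  δ_cyclic : ∀ {r : ℕ} (l : (cell r).Idx) (y : (cell r).Cell l), ∃ a : A r, y = op a • δ l
  α : ∀ {r : ℕ} (l : (cell r).Idx),
    toCellularTower.Layer l ≃ₗ[R] (cell r).Cell l ⊗[R] (cell r).Cell l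
  α_act : ∀ {r : ℕ} (l : (cell r).Idx) (a b : A r) (y z : (cell r).aboveEq l),
    (z : A r) = a * y * b →
    α l (Submodule.Quotient.mk z) =
      TensorProduct.map (Algebra.lsmul R R ((cell r).Cell l) (op ((cell r).inv a)))
        (Algebra.lsmul R R ((cell r).Cell l) (op b)) (α l (Submodule.Quotient.mk y))
  m : ∀ {r : ℕ} (_ : (cell r).Idx), A r
  m_mem : ∀ {r : ℕ} (l : (cell r).Idx), m l ∈ (cell r).aboveEq l
  α_m : ∀ {r : ℕ} (l : (cell r).Idx),
    α l (Submodule.Quotient.mk ⟨m l, m_mem l⟩) = δ l ⊗ₜ[R] δ l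
  inv_m : ∀ {r : ℕ} (l : (cell r).Idx), (cell r).inv (m l) = m l
  split : ∀ r : ℕ, IsSplitSemisimple F (F ⊗[R] A r)
  /-- A cell filtration of the restriction of `Δ_{r+1}(n)` to `A_r`. -/
  filtration : ∀ {r : ℕ} (n : (cell (r + 1)).Idx),
    (cell r).CellFiltration (toCellularTower.ResCell n)
  filtration_order : ∀ {r : ℕ} (n : (cell (r + 1)).Idx), (filtration n).OrderPreserving
  /-- The branching factor `d_{l → n}`. Only its values at edges `l → n` matter. -/
  d : ∀ {r : ℕ} (_ : (cell r).Idx) (_ : (cell (r + 1)).Idx), A (r + 1)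
  /-- The isomorphism `Δ_r(l) ≅ M_{i+1} / M_i`, with `l` the `i`-th label, maps the generator
  `δ l` to the class of `δ n · d_{l → n}`. -/
  d_spec : ∀ {r : ℕ} (n : (cell (r + 1)).Idx) (i : Fin (filtration n).n),
    ∃ h : (show toCellularTower.ResCell n from op (d ((filtration n).label i) n) • δ n) ∈
        (filtration n).M i.succ,
      (filtration n).iso i (δ ((filtration n).label i)) = Submodule.Quotient.mk ⟨_, h⟩
  /-- The compatibility `m_n d_{l → n} = u^* m_l` for the edges `l → n`. -/
  compat : ∀ {r : ℕ} (n : (cell (r + 1)).Idx) (i : Fin (filtration n).n),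
    ∃ u : A (r + 1), m n * d ((filtration n).label i) n =
      (cell (r + 1)).inv u * ι (Nat.le_succ r) (m ((filtration n).label i))

namespace DiagramTower

variable {R : Type u} {F : Type x} {A : ℕ → Type v} [CommRing R] [Field F]
  [Algebra R F] [∀ r, Ring (A r)] [∀ r, Algebra R (A r)]
  (T : DiagramTower.{u, v, w, x} R F A)

abbrev Idx (r : ℕ) := (T.cell r).Idx

abbrev Cell {r : ℕ} (l : T.Idx r) := (T.cell r).Cell l

/-- The edges `l → n` of the branching diagram. By semisimplicity over `F` they do not depend on
the choice of the order preserving cell filtration. -/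
def Edge {r : ℕ} (l : T.Idx r) (n : T.Idx (r + 1)) : Prop :=
  ∃ i, (T.filtration n).label i = l

theorem nonempty_idx_zero [IsDomain R] : Nonempty (T.Idx 0) := by
  by_contra h
  rw [not_nonempty_iff] at h
  have h0 : Subsingleton (A 0) :=
    (T.cell 0).basis.repr.toEquiv.subsingleton
  have := T.zero_eq.injective.subsingleton
  exact not_subsingleton R this

/-- The vertex `∅` of the branching diagram at level `0`, the only one there. -/
def root [IsDomain R] : T.Idx 0 := Classical.choice T.nonempty_idx_zero

/-- A skew standard tableau of shape `n ∖ l`: a path `v s = l → v (s+1) → ⋯ → v r = n` on the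
branching diagram. -/
@[ext]
structure SkewTab {s r : ℕ} (l : T.Idx s) (n : T.Idx r) where
  v : ∀ i : ℕ, s ≤ i ∧ i ≤ r → T.Idx i
  start : ∀ h, v s h = l
  finish : ∀ h, v r h = n
  edge : ∀ (i : ℕ) (h : s ≤ i ∧ i ≤ r) (h' : s ≤ i + 1 ∧ i + 1 ≤ r), T.Edge (v i h) (v (i + 1) h')

/-- The dominance order: `t ≤ t'`, that is `t' ⊵ t`, if `t' (i) ⊵ t (i)` for all `i`. -/
instance {s r : ℕ} (l : T.Idx s) (n : T.Idx r) : PartialOrder (T.SkewTab l n) where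
  le t t' := ∀ i h, t.v i h ≤ t'.v i h
  le_refl t i h := le_refl _
  le_trans t t' t'' h1 h2 i h := (h1 i h).trans (h2 i h)
  le_antisymm t t' h1 h2 :=
    SkewTab.ext (funext fun i => funext fun h => le_antisymm (h1 i h) (h2 i h))

/-- `Std_r(n)`: the paths from `∅` to `n`. -/
abbrev Std [IsDomain R] {r : ℕ} (n : T.Idx r) := T.SkewTab T.root n

variable {T}

/-- The concatenation of two paths. -/
def SkewTab.concat {q s r : ℕ} {k : T.Idx q} {l : T.Idx s} {n : T.Idx r} (hq : q ≤ s) (hr : s ≤ r)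
    (t : T.SkewTab k l) (t' : T.SkewTab l n) : T.SkewTab k n where
  v i h := if hi : i ≤ s then t.v i ⟨h.1, hi⟩ else t'.v i ⟨by omega, h.2⟩
  start h := by rw [dif_pos hq]; exact t.start _
  finish h := by
    split_ifs with hi
    · obtain rfl : s = r := le_antisymm hr hi
      rw [t.finish, ← t'.finish ⟨le_refl _, le_refl _⟩]
      exact (t'.start _).symm
    · exact t'.finish _
  edge i h h' := by
    by_cases h1 : i + 1 ≤ s
    · rw [dif_pos h1, dif_pos (by omega)]
      exact t.edge i _ _
    · rw [dif_neg h1]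
      by_cases h2 : i ≤ s
      · obtain rfl : i = s := by omega
        rw [dif_pos h2, t.finish]
        have h3 := t'.edge i ⟨le_refl _, hr⟩ ⟨by omega, h'.2⟩
        rwa [t'.start] at h3
      · rw [dif_neg h2]
        exact t'.edge i _ _

section Murphy

variable [IsDomain R]

/-- `d_{t(k-1) → t(k)} ⋯ d_{t(0) → t(1)}` as an element of `A k`. -/
def dUpTo {r : ℕ} {n : T.Idx r} (t : T.Std n) : ∀ k : ℕ, k ≤ r → A k
  | 0, _ => 1
  | k + 1, h => T.d (t.v k ⟨Nat.zero_le _, by omega⟩) (t.v (k + 1) ⟨Nat.zero_le _, h⟩) *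
      T.ι (Nat.le_succ k) (dUpTo t k (by omega))

/-- The Murphy basis element `m_t = m_n d_t + A^{▷ n}` of `Δ(n)`. Here `m_n + A^{▷ n}` is
identified with the generator `δ n`, to which it corresponds under `α`. -/
def murphy {r : ℕ} {n : T.Idx r} (t : T.Std n) : T.Cell n := op (dUpTo t r le_rfl) • T.δ n

/-- `Δ(n; ▷ l)`. -/
def spanAbove {s r : ℕ} (h : s ≤ r) (l : T.Idx s) (n : T.Idx r) : Submodule R (T.Cell n) :=
  Submodule.span R {y | ∃ t : T.Std n, l < t.v s ⟨Nat.zero_le _, h⟩ ∧ y = murphy t}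

/-- `Δ(n; t)` for `t` in `Std_s(l)`. -/
def spanThrough {s r : ℕ} (h : s ≤ r) {l : T.Idx s} (t : T.Std l) (n : T.Idx r) :
    Submodule R (T.Cell n) :=
  Submodule.span R {y | ∃ p : T.SkewTab l n, y = murphy (t.concat (Nat.zero_le _) h p)}

end Murphy

variable (T)

/-- `A_r ∩ A_s'`. -/
abbrev commutant {s r : ℕ} (h : s ≤ r) : Subalgebra R (A r) :=
  Subalgebra.centralizer R (Set.range (T.ι h))

/-- The inclusion of `F ⊗ A s` in `F ⊗ A r`. -/
def ιF {s r : ℕ} (h : s ≤ r) : F ⊗[R] A s →ₐ[F] F ⊗[R] A r :=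
  Algebra.TensorProduct.map (AlgHom.id F F) (T.ι h)

/-- The commutant of `F ⊗ A s` in `F ⊗ A r`. -/
abbrev commutantF {s r : ℕ} (h : s ≤ r) : Subalgebra F (F ⊗[R] A r) :=
  Subalgebra.centralizer F (Set.range (T.ιF h))

/-- `Δ_r(n)` as a module over `A_r ∩ A_s'`. -/
abbrev CommCell {s r : ℕ} (h : s ≤ r) (n : T.Idx r) := Res (T.commutant h).val (T.Cell n)

/-- `F ⊗ Δ_r(n)` as a module over the commutant of `F ⊗ A s` in `F ⊗ A r`. -/
abbrev CommCellF {s r : ℕ} (h : s ≤ r) (n : T.Idx r) :=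
  Res (T.commutantF h).val (F ⊗[R] T.Cell n)

/-- The homomorphism `a ↦ 1 ⊗ a` from `A_r ∩ A_s'` to `F ⊗ A r`. -/
def commToF {s r : ℕ} (h : s ≤ r) : T.commutant h →ₐ[R] F ⊗[R] A r :=
  (Algebra.TensorProduct.includeRight : A r →ₐ[R] F ⊗[R] A r).comp (T.commutant h).val

/-- The homomorphism from `F ⊗ (A_r ∩ A_s')` to the commutant of `F ⊗ A s` in `F ⊗ A r`. -/
def commExt {s r : ℕ} (h : s ≤ r) : F ⊗[R] T.commutant h →ₐ[F] T.commutantF h :=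
  (Algebra.TensorProduct.map (AlgHom.id F F) (T.commutant h).val).codRestrict (T.commutantF h)
    (by
      intro y
      rw [Subalgebra.mem_centralizer_iff]
      rintro _ ⟨z, rfl⟩
      induction y using TensorProduct.induction_on with
      | zero => simp
      | add y y' hy hy' => rw [map_add, mul_add, add_mul, hy, hy']
      | tmul c a =>
        induction z using TensorProduct.induction_on with
        | zero => simp
        | add z z' hz hz' => rw [map_add, mul_add, add_mul, hz, hz']
        | tmul e b =>
          have hab := (Subalgebra.mem_centralizer_iff R).mp a.2 (T.ι h b) ⟨b, rfl⟩
          simp [ιF, Algebra.TensorProduct.tmul_mul_tmul, mul_comm, hab])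

theorem commExt_bijective [IsDomain R] [IsFractionRing R F] {s r : ℕ} (h : s ≤ r) :
    Function.Bijective (T.commExt h) := by
  have hfree : Module.Free R (A r) := Module.Free.of_basis (T.cell r).basis
  have : Module.Flat R F := IsLocalization.flat F (nonZeroDivisors R)
  have hinj : Function.Injective (Algebra.TensorProduct.includeRight : A r →ₐ[R] F ⊗[R] A r) :=
    Algebra.TensorProduct.includeRight_injective (IsFractionRing.injective R F)
  constructor
  · intro y z hyz
    have h1 : Algebra.TensorProduct.map (AlgHom.id F F) (T.commutant h).val y =
        Algebra.TensorProduct.map (AlgHom.id F F) (T.commutant h).val z :=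
      congrArg Subtype.val hyz
    exact Module.Flat.lTensor_preserves_injective_linearMap (M := F)
      (T.commutant h).val.toLinearMap Subtype.val_injective h1
  · rintro ⟨y, hy⟩
    obtain ⟨a, c, hc, hca⟩ : ∃ (a : A r) (c : R), c ≠ 0 ∧
        (algebraMap R F c) • y = (1 : F) ⊗ₜ[R] a := by
      clear hy
      induction y using TensorProduct.induction_on with
      | zero => exact ⟨0, 1, one_ne_zero, by simp⟩
      | tmul e b =>
        obtain ⟨p, q, hq, rfl⟩ := IsFractionRing.div_surjective (A := R) e
        have hq' : algebraMap R F q ≠ 0 := by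
          simpa using nonZeroDivisors.ne_zero hq
        refine ⟨p • b, q, nonZeroDivisors.ne_zero hq, ?_⟩
        rw [TensorProduct.smul_tmul', smul_eq_mul, mul_div_cancel₀ _ hq',
          ← TensorProduct.smul_tmul, Algebra.smul_def, mul_one]
      | add y z hy hz =>
        obtain ⟨a, c, hc, ha⟩ := hy
        obtain ⟨b, e, he, hb⟩ := hz
        refine ⟨e • a + c • b, c * e, mul_ne_zero hc he, ?_⟩
        have h1 : algebraMap R F (c * e) • y = algebraMap R F e • (1 : F) ⊗ₜ[R] a := by
          rw [← ha, smul_smul, ← map_mul, mul_comm]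
        have h2 : algebraMap R F (c * e) • z = algebraMap R F c • (1 : F) ⊗ₜ[R] b := by
          rw [← hb, smul_smul, ← map_mul]
        rw [smul_add, h1, h2, algebraMap_smul, algebraMap_smul, TensorProduct.tmul_add,
          TensorProduct.tmul_smul, TensorProduct.tmul_smul]
    have ha : a ∈ T.commutant h := by
      rw [Subalgebra.mem_centralizer_iff]
      rintro _ ⟨b, rfl⟩
      apply hinj
      have h2 := (Subalgebra.mem_centralizer_iff F).mp hy (T.ιF h (1 ⊗ₜ b)) ⟨_, rfl⟩
      have h3 : T.ιF h (1 ⊗ₜ b) * (algebraMap R F c • y) =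
          (algebraMap R F c • y) * T.ιF h (1 ⊗ₜ b) := by
        rw [mul_smul_comm, h2, smul_mul_assoc]
      rw [hca] at h3
      simpa [ιF, Algebra.TensorProduct.tmul_mul_tmul] using h3
    have hc' : algebraMap R F c ≠ 0 := by simpa using hc
    refine ⟨(algebraMap R F c)⁻¹ ⊗ₜ ⟨a, ha⟩, Subtype.ext ?_⟩
    have h4 : (algebraMap R F c)⁻¹ • ((algebraMap R F c) • y) = y := inv_smul_smul₀ hc' y
    rw [hca, TensorProduct.smul_tmul', smul_eq_mul, mul_one] at h4
    exact h4

/-- The identification of `F ⊗ (A_r ∩ A_s')` with the commutant of `F ⊗ A s` in `F ⊗ A r`. -/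
def commExtEquiv [IsDomain R] [IsFractionRing R F] {s r : ℕ} (h : s ≤ r) :
    F ⊗[R] T.commutant h ≃ₐ[F] T.commutantF h :=
  AlgEquiv.ofBijective (T.commExt h) (T.commExt_bijective h)

/-- The minimal central idempotent `z_l` of `F ⊗ A r` that acts as the identity on
`F ⊗ Δ_r(l)`. -/
def centralIdem {r : ℕ} (l : T.Idx r) : F ⊗[R] A r :=
  Classical.epsilon fun e => IsMinimalCentralIdempotent e ∧ ∀ y : F ⊗[R] T.Cell l, op e • y = y

variable {T}

section GelfandZeitlin

variable [IsDomain R]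

/-- `z_{t(1)} ⋯ z_{t(k)}` as an element of `F ⊗ A k`. -/
def gzUpTo {r : ℕ} {n : T.Idx r} (t : T.Std n) : ∀ k : ℕ, k ≤ r → F ⊗[R] A k
  | 0, _ => 1
  | k + 1, h => T.ιF (Nat.le_succ k) (gzUpTo t k (by omega)) *
      T.centralIdem (t.v (k + 1) ⟨Nat.zero_le _, h⟩)

/-- The Gelfand--Zeitlin idempotent `F_t` in `F ⊗ A r`. -/
def gz {r : ℕ} {n : T.Idx r} (t : T.Std n) : F ⊗[R] A r := gzUpTo t r le_rfl

/-- Right multiplication by `F_t` on `F ⊗ Δ_r(n)`, for `t` in `Std_s(l)`. -/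
def mulGZ {s r : ℕ} (h : s ≤ r) {l : T.Idx s} (t : T.Std l) (n : T.Idx r) :
    F ⊗[R] T.Cell n →ₗ[F] F ⊗[R] T.Cell n :=
  Algebra.lsmul F F (F ⊗[R] T.Cell n) (op (T.ιF h (gz t)))

/-- `Δ(n; t) F_t`, an `R`-submodule of `F ⊗ Δ_r(n)`. -/
def spanThroughGZ {s r : ℕ} (h : s ≤ r) {l : T.Idx s} (t : T.Std l) (n : T.Idx r) :
    Submodule R (F ⊗[R] T.Cell n) :=
  (spanThrough h t n).map ((mulGZ h t n).restrictScalars R ∘ₗ TensorProduct.mk R F (T.Cell n) 1)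

/-- `Δ_r^F(n) F_t`, an `F`-subspace of `Δ_r^F(n) = F ⊗ Δ_r(n)`. -/
def cellGZ {s r : ℕ} (h : s ≤ r) {l : T.Idx s} (t : T.Std l) (n : T.Idx r) :
    Submodule F (F ⊗[R] T.Cell n) :=
  LinearMap.range (mulGZ h t n)

end GelfandZeitlin

/-! ### Skew cell modules -/

section Skew

variable [IsDomain R] {s r : ℕ} {h : s ≤ r} {l : T.Idx s} {n : T.Idx r}

variable (h l n) in
/-- `Δ(n; ▷ l)` is closed under the action of `A_r ∩ A_s'`. -/
def AboveStable : Prop :=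
  IsStable (T.commutant h) (N := T.CommCell h n) (spanAbove h l n)

variable (h n) in
/-- `Δ(n; t) + Δ(n; ▷ l)` is closed under the action of `A_r ∩ A_s'`. -/
def ThroughStable (t : T.Std l) : Prop :=
  IsStable (T.commutant h) (N := T.CommCell h n) (spanThrough h t n ⊔ spanAbove h l n : Submodule R (T.Cell n))

/-- The skew cell module `(Δ(n; t) + Δ(n; ▷ l)) / Δ(n; ▷ l)`, a right module over
`A_r ∩ A_s'`. -/
abbrev SkewCell (hN : AboveStable h l n) {t : T.Std l} (hM : ThroughStable h n t) :=
  hM.sub ⧸ hN.sub.submoduleOf hM.sub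

/-- The class of `m_{t ∘ p}` in the skew cell module. -/
def skewMurphy (hN : AboveStable h l n) {t : T.Std l} (hM : ThroughStable h n t)
    (p : T.SkewTab l n) : SkewCell hN hM :=
  Submodule.Quotient.mk ⟨murphy (t.concat (Nat.zero_le _) h p),
    (le_sup_left : spanThrough h t n ≤ _) (Submodule.subset_span ⟨p, rfl⟩)⟩

/-- `F ⊗ Δ(n ∖ l)` as a module over the commutant of `F ⊗ A s` in `F ⊗ A r`. -/
abbrev SkewCellF [IsFractionRing R F] (hN : AboveStable h l n) {t : T.Std l}
    (hM : ThroughStable h n t) :=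
  Res (T.commExtEquiv h).symm.toAlgHom (F ⊗[R] SkewCell hN hM)

end Skew

variable (T)

/-- Automorphisms `f r` of `A r` with square `1` such that `f r` maps `A (r - s)` into the
commutant of `A s`. -/
structure Flips where
  f : ∀ r : ℕ, A r ≃ₐ[R] A r
  f_f : ∀ (r : ℕ) (a : A r), f r (f r a) = a
  comm : ∀ {s r : ℕ} (h : s ≤ r) (a : A s) (b : A (r - s)),
    f r (T.ι (Nat.sub_le r s) b) * T.ι h a = T.ι h a * f r (T.ι (Nat.sub_le r s) b)

/-- The homomorphism `f_r ∘ f_{r-s}` from `A_{r-s}` to `A_r ∩ A_s'`. -/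
def Flips.hom {T : DiagramTower.{u, v, w, x} R F A} (f : T.Flips) {s r : ℕ} (h : s ≤ r) :
    A (r - s) →ₐ[R] T.commutant h :=
  ((f.f r).toAlgHom.comp ((T.ι (Nat.sub_le r s)).comp (f.f (r - s)).toAlgHom)).codRestrict _
    (by
      intro b
      rw [Subalgebra.mem_centralizer_iff]
      rintro _ ⟨a, rfl⟩
      exact (f.comm h a (f.f (r - s) b)).symm)

end DiagramTower

end DiagramAlgebra

open DiagramAlgebra DiagramAlgebra.DiagramTower

namespace DiagramAlgebra

/-! ### Idempotents in split semisimple algebras -/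

/-! Over `F` the cell modules are the irreducible modules. A non-zero element of a split semisimple
algebra generates an ideal that contains a non-zero idempotent, and an idempotent that acts by zero
on all cell modules dies in the cell chain, so the action on their sum is faithful
(`matF_injective`). A dimension count makes it an isomorphism onto a product of matrix algebras
(`matF_bijective`). The `centralIdem l` are then the block units, and the `gz t`, written F_t, are
orthogonal idempotents.

The engine is a triangularity. Iterating the compatibility m_n d = u^* m_l along a path gives m_n
d_t = u m_{t(s)} x (`exists_m_mul_dUpTo`). Since m_{t(s)} lies in A^{⊵ t(s)}, which z_k annihilates
unless t(s) ≤ k, also m_t z_k = 0 unless t(s) ≤ k (`centralIdem_smul_murphy`). Hence m_t F_w = 0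
unless t ≤ w, whereas m_t F_t ≠ 0 (`gz_smul_murphy_self_ne_zero`). For an upper set S of tableaux,
the R-span of the m_t with t in S therefore consists exactly of the vectors of Δ(n) killed by F_w
for all w outside S (`mem_span_of_gz_smul`).

This describes Δ(n; ▷ l), and for maximal t also Δ(n; t) + Δ(n; ▷ l), by the vanishing of products
with elements of F ⊗ A_s. The commutant of A_s respects such conditions, which gives stability.
Moreover y ↦ y F_t embeds the quotient in F ⊗ Δ(n) with image Δ(n; t) F_t, and the triangularity
yields the basis.

To exchange t for q, irreducibility of F ⊗ Δ_s(l) provides an element a of F ⊗ A_s with m_t F_t a =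
m_q F_q (`IsTransport`). The compatibility upgrades this to m_{t∘p} a = m_{q∘p} F_q for every p
(`IsTransport.smul_murphy_concat`), so right multiplication by a matches the two integral forms.
Over `F` it reaches all of Δ^F(n) F_q, whether or not q is maximal. -/

theorem IsSplitSemisimple.exists_idempotent {F A : Type*} [Field F] [Ring A] [Algebra F A]
    (h : IsSplitSemisimple F A) {x : A} (hx : x ≠ 0) :
    ∃ a b : A, IsIdempotentElem (a * x * b) ∧ a * x * b ≠ 0 := by
  classical
  obtain ⟨n, d, -, ⟨e⟩⟩ := h
  have hx' : e x ≠ 0 := by simpa using hx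
  obtain ⟨i, hi⟩ := Function.ne_iff.mp hx'
  obtain ⟨p, q, hpq⟩ : ∃ p q, e x i p q ≠ 0 := by
    by_contra! hc
    exact hi (Matrix.ext hc)
  -- Matrix units on the two sides pick out the non-zero entry (p, q) of `x` and place it, scaled to
  -- 1, at the diagonal position (q, q).
  let a : (i : Fin n) → Matrix (Fin (d i)) (Fin (d i)) F :=
    Pi.single i (Matrix.single q p (e x i p q)⁻¹)
  let b : (i : Fin n) → Matrix (Fin (d i)) (Fin (d i)) F := Pi.single i (Matrix.single q q 1)
  have key : a * e x * b = Pi.single i (Matrix.single q q 1) := by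
    funext j
    by_cases hj : j = i
    · subst hj
      simp only [a, b, Pi.mul_apply, Pi.single_eq_same]
      rw [Matrix.single_mul_mul_single, inv_mul_cancel₀ hpq, one_mul]
    · simp [a, b, Pi.single_eq_of_ne hj]
  have h1 : e.symm a * x * e.symm b = e.symm (Pi.single i (Matrix.single q q 1)) := by
    rw [← key]
    simp
  refine ⟨e.symm a, e.symm b, ?_, ?_⟩
  · rw [h1, IsIdempotentElem, ← map_mul, ← Pi.single_mul, Matrix.single_mul_single_same, one_mul]
  · rw [h1, Ne, map_eq_zero_iff _ e.symm.injective, Pi.single_eq_zero_iff]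
    intro h0
    have := congrFun (congrFun h0 q) q
    simp at this

/-! ### The action of F ⊗ A on its cell modules -/

namespace CellDatum

section Representation

open scoped Classical

variable {R A : Type*} [CommRing R] [Ring A] [Algebra R A] (D : CellDatum R A)
  (F : Type*) [Field F] [Algebra R F]

theorem coeff_one' (l : D.Idx) : (Matrix.of fun t z => D.coeff l 1 t z) = 1 := by
  ext t z
  rw [Matrix.of_apply, D.coeff_one, Matrix.one_apply]
  simp

/-- The matrix representation of `A` on the sum of its cell modules. -/
def mat : A →ₐ[R] ∀ l, Matrix (D.Tab l) (D.Tab l) R :=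
  AlgHom.ofLinearMap
    { toFun := fun a l => Matrix.of fun t z => D.coeff l a t z
      map_add' := fun a b => by
        funext l; ext t z; simp [coeff, mul_add]
      map_smul' := fun c a => by
        funext l; ext t z; simp [coeff] }
    (by funext l; exact D.coeff_one' l)
    (by
      intro a b
      funext l; ext t z
      simp [Matrix.mul_apply, D.coeff_mul])

/-- The matrix representation of `F ⊗ A` on the sum of the cell modules `F ⊗ Δ(l)`. -/
def matF : F ⊗[R] A →ₐ[F] ∀ l, Matrix (D.Tab l) (D.Tab l) F :=
  Algebra.TensorProduct.lift (Algebra.ofId F _)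
    ((AlgHom.pi fun l => ((Algebra.ofId R F).mapMatrix.comp (Pi.evalAlgHom R _ l))).comp D.mat)
    (fun c _ => by rw [Algebra.ofId_apply]; exact Algebra.commute_algebraMap_left c _)

theorem matF_tmul (c : F) (a : A) (l : D.Idx) (t z : D.Tab l) :
    D.matF F (c ⊗ₜ a) l t z = c * algebraMap R F (D.coeff l a t z) := by
  rw [matF, Algebra.TensorProduct.lift_tmul, Algebra.ofId_apply, ← Algebra.smul_def]
  rfl

/-- The coordinates of `F ⊗ Δ(l)`. -/
def coord (l : D.Idx) : F ⊗[R] D.Cell l ≃ₗ[F] (D.Tab l → F) :=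
  TensorProduct.piScalarRight R F F (D.Tab l)

theorem coord_tmul (l : D.Idx) (c : F) (y : D.Cell l) (z : D.Tab l) :
    D.coord F l (c ⊗ₜ y) z = c * algebraMap R F (y z) := by
  refine (congrFun (TensorProduct.piScalarRight_apply R F F (D.Tab l) _) z).trans ?_
  refine (congrFun (TensorProduct.piScalarRightHom_tmul R F F (D.Tab l) c y) z).trans ?_
  rw [Algebra.smul_def, mul_comm]

theorem op_smul_apply (l : D.Idx) (a : A) (y : D.Cell l) (z : D.Tab l) :
    (op a • y : D.Cell l) z = ∑ t, y t * D.coeff l a t z := rfl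

theorem coord_smul (l : D.Idx) (b : F ⊗[R] A) (y : F ⊗[R] D.Cell l) :
    D.coord F l (op b • y) = Matrix.vecMul (D.coord F l y) (D.matF F b l) := by
  induction b using TensorProduct.induction_on with
  | zero => simp
  | add b b' hb hb' =>
    rw [MulOpposite.op_add, add_smul, map_add, hb, hb', map_add, Pi.add_apply, Matrix.vecMul_add]
  | tmul c a =>
    induction y using TensorProduct.induction_on with
    | zero => simp
    | add y y' hy hy' => rw [smul_add, map_add, hy, hy', map_add, Matrix.add_vecMul]
    | tmul e y =>
      rw [op_tmul_smul]
      funext z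
      rw [coord_tmul, op_smul_apply]
      simp only [Matrix.vecMul, dotProduct, coord_tmul, matF_tmul, map_sum, map_mul,
        Finset.mul_sum]
      exact Finset.sum_congr rfl fun t _ => by ring

theorem smul_eq_of_matF_eq {l : D.Idx} {b b' : F ⊗[R] A} (h : D.matF F b l = D.matF F b' l)
    (y : F ⊗[R] D.Cell l) : op b • y = op b' • y :=
  (D.coord F l).injective (by rw [coord_smul, coord_smul, h])

theorem matF_eq_of_smul_eq {l : D.Idx} {b b' : F ⊗[R] A}
    (h : ∀ y : F ⊗[R] D.Cell l, op b • y = op b' • y) : D.matF F b l = D.matF F b' l := by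
  refine Matrix.ext_of_single_vecMul fun i => ?_
  have := congrArg (D.coord F l) (h ((D.coord F l).symm (Pi.single i 1)))
  simpa [coord_smul] using this

/-- `F ⊗ A^{▷ l}`. -/
def aboveF (l : D.Idx) : Submodule F (F ⊗[R] A) :=
  Submodule.span F {y | ∃ (k : D.Idx) (p q : D.Tab k), l < k ∧ y = 1 ⊗ₜ D.basis ⟨k, p, q⟩}

theorem tmul_mem_aboveF {l : D.Idx} {a : A} (ha : a ∈ D.above l) (c : F) :
    c ⊗ₜ a ∈ D.aboveF F l := by
  have hc : c ⊗ₜ[R] a = c • ((1 : F) ⊗ₜ[R] a) := by simp [TensorProduct.smul_tmul']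
  rw [hc]
  refine Submodule.smul_mem _ _ ?_
  clear hc
  induction ha using Submodule.span_induction with
  | mem y h =>
    obtain ⟨k, p, q, hk, rfl⟩ := h
    exact Submodule.subset_span ⟨k, p, q, hk, rfl⟩
  | zero => simp
  | add x y _ _ hx hy => rw [TensorProduct.tmul_add]; exact Submodule.add_mem _ hx hy
  | smul e x _ hx =>
    rw [TensorProduct.tmul_smul, ← algebraMap_smul F e]
    exact Submodule.smul_mem _ _ hx

theorem basis_mul_matF (l : D.Idx) (s t : D.Tab l) (x : F ⊗[R] A) :
    (1 : F) ⊗ₜ[R] D.basis ⟨l, s, t⟩ * x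
      - ∑ z, D.matF F x l t z • ((1 : F) ⊗ₜ[R] D.basis ⟨l, s, z⟩) ∈ D.aboveF F l := by
  induction x using TensorProduct.induction_on with
  | zero => simp
  | add x y hx hy =>
    have := Submodule.add_mem _ hx hy
    simp only [map_add, Pi.add_apply, Matrix.add_apply, add_smul, Finset.sum_add_distrib, mul_add]
    convert this using 1
    abel
  | tmul c a =>
    have := D.tmul_mem_aboveF F (D.basis_mul_coeff l a s t) c
    simp only [matF_tmul, Algebra.TensorProduct.tmul_mul_tmul, one_mul]
    convert this using 1
    rw [TensorProduct.tmul_sub, TensorProduct.tmul_sum]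
    congr 1
    refine Finset.sum_congr rfl fun z _ => ?_
    rw [mul_smul, algebraMap_smul, TensorProduct.smul_tmul', TensorProduct.smul_tmul', smul_eq_mul,
      mul_smul_comm, mul_one, TensorProduct.smul_tmul]

/-- An idempotent that acts by zero on the cell modules `Δ(k)`, for `k ⊵ l`, is annihilated by
`A^{⊵ l}`. -/
theorem basis_mul_eq_zero {e : F ⊗[R] A} (he : IsIdempotentElem e) (l : D.Idx)
    (h : ∀ k, l ≤ k → D.matF F e k = 0) (s t : D.Tab l) :
    (1 : F) ⊗ₜ[R] D.basis ⟨l, s, t⟩ * e = 0 := by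
  have : WellFoundedGT D.Idx := Finite.to_wellFoundedGT
  induction l using WellFoundedGT.induction with
  | ind l ih =>
    have h1 := D.basis_mul_matF F l s t e
    simp only [h l le_rfl, Matrix.zero_apply, zero_smul, Finset.sum_const_zero, sub_zero] at h1
    have h2 : ∀ y ∈ D.aboveF F l, y * e = 0 := by
      intro y hy
      induction hy using Submodule.span_induction with
      | mem y hy =>
        obtain ⟨k, p, q, hk, rfl⟩ := hy
        exact ih k hk (fun j hj => h j (hk.le.trans hj)) p q
      | zero => simp
      | add x y _ _ hx hy => rw [add_mul, hx, hy, add_zero]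
      | smul c x _ hx => rw [smul_mul_assoc, hx, smul_zero]
    -- As `e` acts by zero on Δ(l), the product of the basis element with `e` lies in F ⊗ A^{▷ l}.
    -- Multiplying by `e` once more changes nothing, yet gives zero by induction.
    have h3 := h2 _ h1
    rwa [mul_assoc, he] at h3

theorem eq_zero_of_basis_mul {e : F ⊗[R] A}
    (h : ∀ l s t, (1 : F) ⊗ₜ[R] D.basis ⟨l, s, t⟩ * e = 0) : e = 0 := by
  have h1 : LinearMap.mulRight F e = 0 := by
    refine (D.basis.baseChange F).ext fun i => ?_
    obtain ⟨l, s, t⟩ := i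
    simpa using h l s t
  simpa using congrArg (fun f => f 1) h1

variable {F}

/-- Semisimplicity enters here: the ideal generated by a non-zero element of the kernel would
contain a non-zero idempotent, and that idempotent would act by zero on every cell module. -/
theorem matF_injective (hF : IsSplitSemisimple F (F ⊗[R] A)) :
    Function.Injective (D.matF F) := by
  rw [injective_iff_map_eq_zero]
  intro x hx
  by_contra hx0
  obtain ⟨a, b, h1, h2⟩ := hF.exists_idempotent hx0
  refine h2 (D.eq_zero_of_basis_mul F fun l s t => D.basis_mul_eq_zero F h1 l (fun k _ => ?_) s t)
  rw [map_mul, map_mul, hx, mul_zero, zero_mul, Pi.zero_apply]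

/-- Both sides have dimension equal to the sum of the squares of the |Tab l|, the size of the
cellular basis. -/
theorem matF_bijective (hF : IsSplitSemisimple F (F ⊗[R] A)) :
    Function.Bijective (D.matF F) := by
  have := Fintype.ofFinite D.Idx
  have hinj := D.matF_injective hF
  have : FiniteDimensional F (F ⊗[R] A) := Module.Basis.finiteDimensional_of_finite (D.basis.baseChange F)
  refine ⟨hinj, ?_⟩
  refine (LinearMap.injective_iff_surjective_of_finrank_eq_finrank
    (f := (D.matF F).toLinearMap) ?_).mp hinj
  rw [Module.finrank_eq_card_basis (D.basis.baseChange F), Module.finrank_pi_fintype]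
  simp [Module.finrank_matrix]

theorem exists_minimal_central (hF : IsSplitSemisimple F (F ⊗[R] A)) (l : D.Idx) :
    ∃ e : F ⊗[R] A, D.matF F e = Pi.single l 1 ∧ IsMinimalCentralIdempotent e ∧
      ∀ y : F ⊗[R] D.Cell l, op e • y = y := by
  obtain ⟨hinj, hsurj⟩ := D.matF_bijective hF
  obtain ⟨e, he⟩ := hsurj (Pi.single l 1)
  refine ⟨e, he, ⟨⟨?_, ?_⟩, ?_, ?_⟩, fun y => ?_⟩
  · rw [Subring.mem_center_iff]
    intro b
    apply hinj
    rw [map_mul, map_mul, he]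
    funext k
    by_cases hk : k = l
    · subst hk; simp
    · simp [Pi.single_eq_of_ne hk]
  · apply hinj
    rw [map_mul, he, ← Pi.single_mul, mul_one]
  · rintro rfl
    rw [map_zero, eq_comm, Pi.single_eq_zero_iff] at he
    exact one_ne_zero he
  · rintro f ⟨hf, hff⟩ hf0 hfe
    have hk : ∀ k, k ≠ l → D.matF F f k = 0 := fun k hk => by
      rw [← hfe, map_mul, he, Pi.mul_apply, Pi.single_eq_of_ne hk, mul_zero]
    -- By surjectivity the block of the central element `f` commutes with all matrix units, so it is
    -- a scalar. An idempotent scalar is 0 or 1, and 0 would make `f` vanish.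
    obtain ⟨c, hc⟩ : D.matF F f l ∈ Set.range (Matrix.scalar (D.Tab l)) := by
      refine Matrix.mem_range_scalar_of_commute_single fun i j _ => ?_
      obtain ⟨b, hb⟩ := hsurj (Pi.single l (Matrix.single i j 1))
      have := congrArg (fun x => D.matF F x l) (Subring.mem_center_iff.mp hf b)
      simpa [hb, Commute, SemiconjBy] using this
    have hcc : c * c = c := by
      have := congrArg (fun x => D.matF F x l) hff
      rw [map_mul, Pi.mul_apply, ← hc, ← map_mul] at this
      exact Matrix.scalar_inj.mp this
    apply hinj
    rw [he]
    funext k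
    by_cases hkl : k = l
    · subst hkl
      rw [Pi.single_eq_same, ← hc]
      rcases eq_or_ne c 0 with rfl | h0
      · refine absurd (hinj ?_) hf0
        rw [map_zero]
        funext j
        by_cases hj : j = k
        · subst hj; rw [← hc, map_zero]; rfl
        · exact hk j hj
      · rw [mul_right_cancel₀ h0 (hcc.trans (one_mul c).symm), map_one]
    · rw [hk k hkl, Pi.single_eq_of_ne hkl]
  · have h1 : D.matF F e l = D.matF F 1 l := by rw [he, map_one]; simp
    rw [D.smul_eq_of_matF_eq F h1, MulOpposite.op_one, one_smul]

/-- A minimal central idempotent of `F ⊗ A` that acts by one on `F ⊗ Δ(l)` acts by zero on the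
other cell modules. -/
theorem matF_eq_single (hF : IsSplitSemisimple F (F ⊗[R] A)) (l : D.Idx)
    {e : F ⊗[R] A} (he : IsMinimalCentralIdempotent e)
    (h : ∀ y : F ⊗[R] D.Cell l, op e • y = y) : D.matF F e = Pi.single l 1 := by
  obtain ⟨z, hz, ⟨⟨hz1, hz2⟩, hz3, hz4⟩, -⟩ := D.exists_minimal_central hF l
  obtain ⟨⟨he1, he2⟩, he3, he4⟩ := he
  have hel : D.matF F e l = 1 := by
    rw [D.matF_eq_of_smul_eq F (b' := 1) (fun y => by rw [h, MulOpposite.op_one, one_smul]),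
      map_one, Pi.one_apply]
  have hez : e * z = z := by
    apply (D.matF_bijective hF).1
    rw [map_mul, hz]
    funext k
    by_cases hk : k = l
    · subst hk; simp [hel]
    · simp [Pi.single_eq_of_ne hk]
  have hze : z * e = z := by rw [Subring.mem_center_iff.mp he1 z, hez]
  rw [← he4 z ⟨hz1, hz2⟩ hz3 hze, hz]

end Representation

end CellDatum

/-- Clearing denominators: questions over `F` are reduced to integral vectors, to which the cell
filtrations and the Murphy span over `R` apply. -/
theorem exists_smul_eq_one_tmul {R F M : Type*} [CommRing R] [IsDomain R] [Field F] [Algebra R F]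
    [IsFractionRing R F] [AddCommGroup M] [Module R M] (x : F ⊗[R] M) :
    ∃ (c : R) (y : M), algebraMap R F c ≠ 0 ∧ algebraMap R F c • x = 1 ⊗ₜ y := by
  have hF : ∀ {c : R}, c ≠ 0 → algebraMap R F c ≠ 0 := fun {c} hc => by simpa using hc
  suffices ∃ (c : R) (y : M), c ≠ 0 ∧ algebraMap R F c • x = 1 ⊗ₜ y by
    obtain ⟨c, y, hc, h⟩ := this
    exact ⟨c, y, hF hc, h⟩
  induction x using TensorProduct.induction_on with
  | zero => exact ⟨1, 0, one_ne_zero, by simp⟩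
  | tmul e y =>
    obtain ⟨p, q, hq, rfl⟩ := IsFractionRing.div_surjective (A := R) e
    have hq0 := nonZeroDivisors.ne_zero hq
    refine ⟨q, p • y, hq0, ?_⟩
    rw [TensorProduct.smul_tmul', smul_eq_mul, mul_div_cancel₀ _ (hF hq0),
      ← TensorProduct.smul_tmul, Algebra.smul_def, mul_one]
  | add y z hy hz =>
    obtain ⟨c, a, hc, ha⟩ := hy
    obtain ⟨e, b, he, hb⟩ := hz
    refine ⟨c * e, e • a + c • b, mul_ne_zero hc he, ?_⟩
    have h1 : algebraMap R F (c * e) • y = algebraMap R F e • (1 : F) ⊗ₜ[R] a := by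
      rw [← ha, smul_smul, ← map_mul, mul_comm]
    have h2 : algebraMap R F (c * e) • z = algebraMap R F c • (1 : F) ⊗ₜ[R] b := by
      rw [← hb, smul_smul, ← map_mul]
    rw [smul_add, h1, h2, algebraMap_smul, algebraMap_smul, TensorProduct.tmul_add,
      TensorProduct.tmul_smul, TensorProduct.tmul_smul]

/-! ### Torsion-freeness of cell modules and annihilators of the cell ideals -/

namespace CellDatum

variable {R A : Type*} [CommRing R] [Ring A] [Algebra R A] (D : CellDatum R A)

theorem inv_one : D.inv 1 = 1 := by
  have h := D.inv_mul (D.inv 1) 1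
  rw [mul_one, D.inv_inv, mul_one] at h
  exact h.symm

theorem aboveEq_mul {l : D.Idx} {y : A} (hy : y ∈ D.aboveEq l) (a : A) : y * a ∈ D.aboveEq l := by
  induction hy using Submodule.span_induction with
  | mem y h =>
    obtain ⟨k, p, q, hk, rfl⟩ := h
    have h1 := D.basis_mul_coeff k a p q
    have h2 : D.above k ≤ D.aboveEq l := Submodule.span_mono (by
      rintro _ ⟨k', p, q, hk', rfl⟩
      exact ⟨k', p, q, hk.trans hk'.le, rfl⟩)
    have h3 : ∑ z, D.coeff k a q z • D.basis ⟨k, p, z⟩ ∈ D.aboveEq l :=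
      Submodule.sum_mem _ fun z _ =>
        Submodule.smul_mem _ _ (Submodule.subset_span ⟨k, p, z, hk, rfl⟩)
    have h4 := Submodule.add_mem _ (h2 h1) h3
    rwa [sub_add_cancel] at h4
  | zero => simp
  | add x y _ _ hx hy => rw [add_mul]; exact Submodule.add_mem _ hx hy
  | smul c x _ hx => rw [smul_mul_assoc]; exact Submodule.smul_mem _ _ hx

theorem eq_zero_of_smul_cell [IsDomain R] {l : D.Idx} {c : R} (hc : c ≠ 0) {y : D.Cell l}
    (h : c • y = 0) : y = 0 :=
  funext fun z => (mul_eq_zero.mp (congrFun h z)).resolve_left hc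

instance [Nontrivial R] (l : D.Idx) : Nontrivial (D.Cell l) :=
  inferInstanceAs (Nontrivial (D.Tab l → R))

/-- A tensor `x ⊗ y` of elements of a cell module is zero only if `x` or `y` is. -/
theorem eq_zero_of_tmul_cell [IsDomain R] {l k : D.Idx} {x : D.Cell l} {y : D.Cell k}
    (hx : x ≠ 0) (h : x ⊗ₜ[R] y = 0) : y = 0 := by
  obtain ⟨i, hi⟩ : ∃ i, x i ≠ 0 := by
    by_contra! hc
    exact hx (funext hc)
  let f : D.Cell l →ₗ[R] R := (LinearMap.proj i : (D.Tab l → R) →ₗ[R] R)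
  have h1 : TensorProduct.lid R (D.Cell k) (TensorProduct.map f LinearMap.id (x ⊗ₜ[R] y)) = 0 := by
    rw [h, map_zero, map_zero]
  refine D.eq_zero_of_smul_cell hi ?_
  rw [← h1]
  exact (TensorProduct.lid_tmul _ _).symm

theorem eq_zero_of_one_tmul_cell [IsDomain R] {F : Type*} [Field F] [Algebra R F]
    [IsFractionRing R F] {l : D.Idx} {y : D.Cell l} (h : (1 : F) ⊗ₜ[R] y = 0) : y = 0 := by
  funext z
  have h1 := D.coord_tmul F l 1 y z
  rw [h, map_zero, one_mul] at h1
  exact (IsFractionRing.injective R F) (h1.symm.trans (map_zero _).symm)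

theorem one_tmul_injective [IsDomain R] (F : Type*) [Field F] [Algebra R F]
    [IsFractionRing R F] (D : CellDatum R A) :
    Function.Injective fun a : A => (1 : F) ⊗ₜ[R] a := by
  have hfree : Module.Free R A := Module.Free.of_basis D.basis
  exact Algebra.TensorProduct.includeRight_injective (IsFractionRing.injective R F)

/-- A central idempotent that acts by zero on `Δ(k)`, for `k ⊵ l`, is annihilated by
`A^{⊵ l}`. -/
theorem aboveEq_mul_eq_zero {F : Type*} [Field F] [Algebra R F] {e : F ⊗[R] A}
    (he : IsIdempotentElem e) {l : D.Idx} (h : ∀ k, l ≤ k → D.matF F e k = 0) {a : A}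
    (ha : a ∈ D.aboveEq l) : (1 : F) ⊗ₜ[R] a * e = 0 := by
  induction ha using Submodule.span_induction with
  | mem y hy =>
    obtain ⟨k, p, q, hk, rfl⟩ := hy
    exact D.basis_mul_eq_zero F he k (fun j hj => h j (hk.trans hj)) p q
  | zero => simp
  | add x y _ _ hx hy => rw [TensorProduct.tmul_add, add_mul, hx, hy, add_zero]
  | smul c x _ hx => rw [TensorProduct.tmul_smul, smul_mul_assoc, hx, smul_zero]

theorem above_mul_eq_zero {F : Type*} [Field F] [Algebra R F] {e : F ⊗[R] A}
    (he : IsIdempotentElem e) {l : D.Idx} (h : ∀ k, l < k → D.matF F e k = 0) {a : A}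
    (ha : a ∈ D.above l) : (1 : F) ⊗ₜ[R] a * e = 0 := by
  induction ha using Submodule.span_induction with
  | mem y hy =>
    obtain ⟨k, p, q, hk, rfl⟩ := hy
    exact D.basis_mul_eq_zero F he k (fun j hj => h j (hk.trans_le hj)) p q
  | zero => simp
  | add x y _ _ hx hy => rw [TensorProduct.tmul_add, add_mul, hx, hy, add_zero]
  | smul c x _ hx => rw [TensorProduct.tmul_smul, smul_mul_assoc, hx, smul_zero]

end CellDatum

namespace DiagramTower

variable {R F : Type*} {A : ℕ → Type*} [CommRing R] [Field F] [Algebra R F] [∀ r, Ring (A r)]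
  [∀ r, Algebra R (A r)] (T : DiagramTower R F A)

/-! ### The central idempotents of the tower -/

-- The condition that defines `centralIdem` by choice is satisfiable and determines the image under
-- `matF`. Identities between these idempotents can thus be checked block by block.
open scoped Classical in
theorem matF_centralIdem {r : ℕ} (l : T.Idx r) :
    (T.cell r).matF F (T.centralIdem l) = Pi.single l 1 := by
  obtain ⟨e, -, he⟩ := (T.cell r).exists_minimal_central (T.split r) l
  obtain ⟨h1, h2⟩ := Classical.epsilon_spec
    (p := fun e => IsMinimalCentralIdempotent e ∧ ∀ y : F ⊗[R] T.Cell l, op e • y = y) ⟨e, he⟩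
  exact (T.cell r).matF_eq_single (T.split r) l h1 h2

open scoped Classical in
theorem matF_centralIdem_self {r : ℕ} (l : T.Idx r) :
    (T.cell r).matF F (T.centralIdem l) l = 1 := by
  rw [matF_centralIdem, Pi.single_eq_same]

theorem matF_centralIdem_of_ne {r : ℕ} {l k : T.Idx r} (h : k ≠ l) :
    (T.cell r).matF F (T.centralIdem l) k = 0 := by
  classical
  rw [matF_centralIdem, Pi.single_eq_of_ne h]

theorem centralIdem_smul {r : ℕ} {l : T.Idx r} (y : F ⊗[R] T.Cell l) :
    op (T.centralIdem l) • y = y := by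
  classical
  rw [(T.cell r).smul_eq_of_matF_eq F (b' := 1), MulOpposite.op_one, one_smul]
  rw [matF_centralIdem_self, map_one, Pi.one_apply]

theorem centralIdem_comm {r : ℕ} (l : T.Idx r) (b : F ⊗[R] A r) :
    T.centralIdem l * b = b * T.centralIdem l := by
  classical
  apply (T.cell r).matF_injective (T.split r)
  rw [map_mul, map_mul, matF_centralIdem]
  funext k
  by_cases hk : k = l
  · subst hk; simp
  · simp [Pi.single_eq_of_ne hk]

theorem centralIdem_mul_self {r : ℕ} (l : T.Idx r) :
    T.centralIdem l * T.centralIdem l = T.centralIdem l := by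
  classical
  apply (T.cell r).matF_injective (T.split r)
  rw [map_mul, matF_centralIdem, ← Pi.single_mul, mul_one]

theorem centralIdem_mul_of_ne {r : ℕ} {l k : T.Idx r} (h : l ≠ k) :
    T.centralIdem l * T.centralIdem k = 0 := by
  classical
  apply (T.cell r).matF_injective (T.split r)
  rw [map_mul, matF_centralIdem, matF_centralIdem, map_zero]
  funext j
  by_cases hj : j = l
  · subst hj; simp [Pi.single_eq_of_ne h]
  · simp [Pi.single_eq_of_ne hj]

theorem ιF_tmul {s r : ℕ} (h : s ≤ r) (c : F) (a : A s) : T.ιF h (c ⊗ₜ a) = c ⊗ₜ T.ι h a := rfl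

theorem ιF_refl {r : ℕ} (b : F ⊗[R] A r) : T.ιF le_rfl b = b := by
  induction b using TensorProduct.induction_on with
  | zero => simp
  | add x y hx hy => rw [map_add, hx, hy]
  | tmul c a => rw [ιF_tmul, T.ι_refl]

theorem ιF_trans {q s r : ℕ} (h : q ≤ s) (h' : s ≤ r) (b : F ⊗[R] A q) :
    T.ιF h' (T.ιF h b) = T.ιF (h.trans h') b := by
  induction b using TensorProduct.induction_on with
  | zero => simp
  | add x y hx hy => simp only [map_add, hx, hy]
  | tmul c a => rw [ιF_tmul, ιF_tmul, ιF_tmul, T.ι_trans]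

/-! ### The generators of the cell modules -/

section Generators

variable [IsDomain R]

theorem δ_ne_zero {r : ℕ} (l : T.Idx r) : T.δ l ≠ 0 := by
  intro h
  obtain ⟨y, hy⟩ := exists_ne (0 : T.Cell l)
  obtain ⟨a, ha⟩ := T.δ_cyclic l y
  exact hy (by rw [ha, h, smul_zero])

omit [IsDomain R] in
theorem α_m_mul {r : ℕ} (l : T.Idx r) (b : A r) :
    T.α l (Submodule.Quotient.mk
      ⟨T.m l * b, (T.cell r).aboveEq_mul (T.m_mem l) b⟩) = T.δ l ⊗ₜ (op b • T.δ l) := by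
  rw [T.α_act l 1 b ⟨T.m l, T.m_mem l⟩ _ (by rw [one_mul]), T.α_m, (T.cell r).inv_one,
    TensorProduct.map_tmul]
  simp

/-- Under α the class of m_l b is δ ⊗ δ b, and tensoring with the non-zero vector δ loses nothing
over a domain. This is the dictionary between products m_l b in the algebra and vectors of the cell
module. -/
theorem m_mul_mem_above_iff {r : ℕ} (l : T.Idx r) (b : A r) :
    T.m l * b ∈ (T.cell r).above l ↔ op b • T.δ l = 0 := by
  have h1 := T.α_m_mul l b
  have h2 : (Submodule.Quotient.mk ⟨T.m l * b, (T.cell r).aboveEq_mul (T.m_mem l) b⟩ :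
      T.Layer l) = 0 ↔ T.m l * b ∈ (T.cell r).above l := by
    rw [Submodule.Quotient.mk_eq_zero]; rfl
  rw [← h2, ← (T.α l).map_eq_zero_iff, h1]
  constructor
  · exact (T.cell r).eq_zero_of_tmul_cell (T.δ_ne_zero l)
  · intro h; rw [h, TensorProduct.tmul_zero]

variable [IsFractionRing R F]

theorem smul_δ_eq_zero {r : ℕ} {l : T.Idx r} {x : F ⊗[R] A r} (h : (1 : F) ⊗ₜ[R] T.m l * x = 0) :
    op x • ((1 : F) ⊗ₜ[R] T.δ l) = 0 := by
  obtain ⟨c, a, hc, ha⟩ := exists_smul_eq_one_tmul x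
  have h1 : T.m l * a = 0 := by
    apply (T.cell r).one_tmul_injective F
    have : (1 : F) ⊗ₜ[R] T.m l * (algebraMap R F c • x) = 0 := by rw [mul_smul_comm, h, smul_zero]
    rw [ha, Algebra.TensorProduct.tmul_mul_tmul, one_mul] at this
    simpa using this
  have h2 : op a • T.δ l = 0 := (T.m_mul_mem_above_iff l a).mp (by rw [h1]; exact zero_mem _)
  have h3 : algebraMap R F c • (op x • ((1 : F) ⊗ₜ[R] T.δ l)) = 0 := by
    rw [← smul_assoc, ← MulOpposite.op_smul, ha, op_tmul_smul, h2, TensorProduct.tmul_zero]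
  exact (smul_eq_zero_iff_right hc).mp h3

-- The source of the triangularity: m_l lies in A^{⊵ l}, and z_k acts by zero on all Δ(j) with j ⊵ l
-- unless k is such a j.
omit [IsDomain R] [IsFractionRing R F] in
theorem m_mul_centralIdem {r : ℕ} {l k : T.Idx r} (h : ¬ l ≤ k) (x : F ⊗[R] A r) :
    (1 : F) ⊗ₜ[R] T.m l * x * T.centralIdem k = 0 := by
  rw [mul_assoc, ← T.centralIdem_comm, ← mul_assoc,
    (T.cell r).aboveEq_mul_eq_zero (T.centralIdem_mul_self k) (fun j hj =>
      T.matF_centralIdem_of_ne (by rintro rfl; exact h hj)) (T.m_mem l), zero_mul]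

/-- If δ x = 0, then after clearing denominators m_l x lies only in A^{▷ l}. The factor z_l removes
this error, since it acts by zero on every Δ(j) with j ▷ l. -/
theorem m_mul_mul_centralIdem {r : ℕ} {l : T.Idx r} {x : F ⊗[R] A r}
    (h : op x • ((1 : F) ⊗ₜ[R] T.δ l) = 0) : (1 : F) ⊗ₜ[R] T.m l * x * T.centralIdem l = 0 := by
  obtain ⟨c, a, hc, ha⟩ := exists_smul_eq_one_tmul x
  have h1 : op a • T.δ l = 0 := by
    apply (T.cell r).eq_zero_of_one_tmul_cell (F := F)
    have := op_tmul_smul R F (A r) (T.Cell l) 1 1 a (T.δ l)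
    rw [one_mul] at this
    rw [← this, ← ha, MulOpposite.op_smul, smul_assoc, h, smul_zero]
  have h2 := (T.cell r).above_mul_eq_zero (T.centralIdem_mul_self l)
    (fun j hj => T.matF_centralIdem_of_ne hj.ne') ((T.m_mul_mem_above_iff l a).mpr h1)
  have h3 : algebraMap R F c • ((1 : F) ⊗ₜ[R] T.m l * x * T.centralIdem l) = 0 := by
    rw [← smul_mul_assoc, ← mul_smul_comm, ha, Algebra.TensorProduct.tmul_mul_tmul, one_mul, h2]
  exact (smul_eq_zero_iff_right hc).mp h3

end Generators

end DiagramTower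

namespace DiagramTower

variable {R F : Type*} {A : ℕ → Type*} [CommRing R] [Field F] [Algebra R F] [∀ r, Ring (A r)]
  [∀ r, Algebra R (A r)] {T : DiagramTower R F A}

/-! ### Paths on the branching diagram -/

theorem Edge.compat {r : ℕ} {l : T.Idx r} {n : T.Idx (r + 1)} (h : T.Edge l n) :
    ∃ u : A (r + 1), T.m n * T.d l n = u * T.ι (Nat.le_succ r) (T.m l) := by
  obtain ⟨i, rfl⟩ := h
  obtain ⟨u, hu⟩ := T.compat n i
  exact ⟨_, hu⟩

/-- Modulo the previous step of the filtration, δ_n d a is the image of δ_l a under the isomorphism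
with Δ(l). -/
theorem Edge.smul_δ_ne_zero {r : ℕ} {l : T.Idx r} {n : T.Idx (r + 1)} (h : T.Edge l n) {a : A r}
    (ha : op a • T.δ l ≠ 0) : op (T.d l n * T.ι (Nat.le_succ r) a) • T.δ n ≠ 0 := by
  obtain ⟨i, rfl⟩ := h
  obtain ⟨h1, h2⟩ := T.d_spec n i
  intro h0
  apply ha
  rw [← ((T.filtration n).iso i).map_eq_zero_iff, map_smul, h2, ← Submodule.Quotient.mk_smul]
  rw [MulOpposite.op_mul, mul_smul] at h0
  have h3 : op a • (⟨_, h1⟩ : (T.filtration n).M i.succ) = 0 := Subtype.ext h0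
  rw [h3, Submodule.Quotient.mk_zero]

/-- An `R`-submodule of `Δ(n)` is everything if, for each edge `l → n`, it contains lifts of the
elements of the subquotient `Δ(l)`. -/
theorem eq_top_of_lift {r : ℕ} {n : T.Idx (r + 1)} (N : Submodule R (T.Cell n))
    (h : ∀ l : T.Idx r, T.Edge l n → ∀ z : T.Cell l, ∃ a : A r, z = op a • T.δ l ∧
      op (T.d l n * T.ι (Nat.le_succ r) a) • T.δ n ∈ N) : N = ⊤ := by
  have key : ∀ i, ∀ y ∈ (T.filtration n).M i, (show T.Cell n from y) ∈ N := by
    intro i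
    induction i using Fin.induction with
    | zero =>
      intro y hy
      rw [(T.filtration n).M_zero, Submodule.mem_bot] at hy
      rw [hy]
      exact N.zero_mem
    | succ i ih =>
      intro y hy
      obtain ⟨z, hz⟩ := ((T.filtration n).iso i).surjective (Submodule.Quotient.mk ⟨y, hy⟩)
      obtain ⟨a, rfl, ha⟩ := h _ ⟨i, rfl⟩ z
      obtain ⟨h1, h2⟩ := T.d_spec n i
      rw [map_smul, h2, ← Submodule.Quotient.mk_smul, eq_comm, Submodule.Quotient.eq] at hz
      have h3 := N.add_mem (ih _ hz) ha
      convert h3 using 1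
      rw [MulOpposite.op_mul, mul_smul]
      exact (sub_add_cancel (G := T.Cell n) y _).symm
  rw [eq_top_iff]
  intro y _
  exact key (Fin.last _) y (by rw [(T.filtration n).M_last]; trivial)

namespace SkewTab

/-- The path with a single edge. -/
def ofEdge {r : ℕ} {l : T.Idx r} {n : T.Idx (r + 1)} (e : T.Edge l n) : T.SkewTab l n where
  v i h := if hi : i = r then cast (congrArg T.Idx hi.symm) l
    else cast (congrArg T.Idx (by omega : r + 1 = i)) n
  start h := by rw [dif_pos rfl]; rfl
  finish h := by rw [dif_neg (by omega)]; rfl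
  edge i h h' := by
    obtain rfl : i = r := by omega
    rw [dif_pos rfl, dif_neg (by omega)]
    exact e

variable {q s r : ℕ} {k : T.Idx q} {l : T.Idx s} {n : T.Idx r}

/-- The initial part of a path. -/
def take (t : T.SkewTab k n) (h : q ≤ s) (h' : s ≤ r) : T.SkewTab k (t.v s ⟨h, h'⟩) where
  v i hi := t.v i ⟨hi.1, hi.2.trans h'⟩
  start _ := t.start _
  finish _ := rfl
  edge i _ _ := t.edge i _ _

/-- The final part of a path. -/
def drop (t : T.SkewTab k n) (h : q ≤ s) (h' : s ≤ r) : T.SkewTab (t.v s ⟨h, h'⟩) n where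
  v i hi := t.v i ⟨h.trans hi.1, hi.2⟩
  start _ := rfl
  finish _ := t.finish _
  edge i _ _ := t.edge i _ _

theorem take_concat_drop (t : T.SkewTab k n) (h : q ≤ s) (h' : s ≤ r) :
    (t.take h h').concat h h' (t.drop h h') = t := by
  ext i hi
  simp only [concat, take, drop]
  split_ifs <;> rfl

theorem exists_concat_eq (t : T.SkewTab k n) (h : q ≤ s) (h' : s ≤ r) (hl : t.v s ⟨h, h'⟩ = l) :
    ∃ (a : T.SkewTab k l) (b : T.SkewTab l n), a.concat h h' b = t := by
  subst hl
  exact ⟨_, _, t.take_concat_drop h h'⟩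

theorem concat_v_of_le (a : T.SkewTab k l) (b : T.SkewTab l n) (h : q ≤ s) (h' : s ≤ r) {i : ℕ}
    (hi : q ≤ i ∧ i ≤ r) (his : i ≤ s) : (a.concat h h' b).v i hi = a.v i ⟨hi.1, his⟩ :=
  dif_pos his

theorem concat_v_of_ge (a : T.SkewTab k l) (b : T.SkewTab l n) (h : q ≤ s) (h' : s ≤ r) {i : ℕ}
    (hi : q ≤ i ∧ i ≤ r) (his : s ≤ i) : (a.concat h h' b).v i hi = b.v i ⟨his, hi.2⟩ := by
  rcases his.eq_or_lt with rfl | h1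
  · rw [concat_v_of_le _ _ _ _ _ le_rfl, a.finish, b.start]
  · exact dif_neg (by omega)

theorem concat_left_injective (a : T.SkewTab k l) (h : q ≤ s) (h' : s ≤ r) :
    Function.Injective fun b : T.SkewTab l n => a.concat h h' b := by
  intro b b' hb
  ext i hi
  have := congrFun (congrFun (congrArg v hb) i) ⟨h.trans hi.1, hi.2⟩
  simpa only [concat_v_of_ge _ _ h h' _ hi.1] using this

instance : Finite (T.SkewTab k n) := by
  refine Finite.of_injective (β := ∀ i : Fin (r + 1), q ≤ i → T.Idx i)
    (fun t i h => t.v i ⟨h, by omega⟩) fun t t' h => ?_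
  ext i hi
  exact congrFun (congrFun h ⟨i, by omega⟩) hi.1

end SkewTab

/-! ### The root of the branching diagram -/

section Murphy

variable [IsDomain R]

/-- `A 0 = R` has rank one, so its cellular basis has a single element. -/
instance : Subsingleton (T.Idx 0) := by
  have e : R ≃ₗ[R] A 0 := LinearEquiv.ofBijective (Algebra.linearMap R (A 0)) T.zero_eq
  have := Fintype.ofFinite (T.Idx 0)
  have h1 := Module.finrank_eq_card_basis (T.cell 0).basis
  rw [← e.finrank_eq, Module.finrank_self] at h1
  have h2 := Fintype.card_le_one_iff_subsingleton.mp h1.ge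
  constructor
  intro i j
  obtain ⟨p⟩ := (T.cell 0).nonemptyTab i
  obtain ⟨q⟩ := (T.cell 0).nonemptyTab j
  exact congrArg Sigma.fst (h2.elim (⟨i, p, p⟩ : Σ l, (T.cell 0).Tab l × (T.cell 0).Tab l)
    ⟨j, q, q⟩)

/-- This is why F_t may start with the factor at level 1: the factor at level 0 is trivial. -/
theorem centralIdem_zero (l : T.Idx 0) : T.centralIdem l = 1 := by
  classical
  apply (T.cell 0).matF_injective (T.split 0)
  rw [map_one]
  funext k
  obtain rfl := Subsingleton.elim l k
  exact T.matF_centralIdem_self l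

/-! ### Branching factors along a path -/

variable {s r : ℕ} {l : T.Idx s} {n : T.Idx r}

theorem dUpTo_congr (t : T.Std l) (t' : T.Std n) {k : ℕ} (hs : k ≤ s) (hr : k ≤ r)
    (h : ∀ i (hi : i ≤ k), t.v i ⟨Nat.zero_le _, hi.trans hs⟩ = t'.v i ⟨Nat.zero_le _, hi.trans hr⟩) :
    dUpTo t k hs = dUpTo t' k hr := by
  induction k with
  | zero => rfl
  | succ k ih =>
    rw [dUpTo, dUpTo, ih (by omega) (by omega) fun i hi => h i (by omega), h k (by omega),
      h (k + 1) le_rfl]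

/-- The edges of `p` contribute a factor `D` that is the same for all `t`, and the edgewise
compatibilities compose along `p`. The independence of `t` is what later allows two tableaux to be
compared under a common `p`. -/
theorem exists_dUpTo_concat (h : s ≤ r) (p : T.SkewTab l n) :
    ∃ D : A r, (∃ u, T.m n * D = u * T.ι h (T.m l)) ∧
      ∀ t : T.Std l, dUpTo (t.concat (Nat.zero_le _) h p) r le_rfl
        = D * T.ι h (dUpTo t s le_rfl) := by
  suffices H : ∀ j (hj : s ≤ j) (hjr : j ≤ r), ∃ D : A j,
      (∃ u, T.m (p.v j ⟨hj, hjr⟩) * D = u * T.ι hj (T.m l)) ∧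
      ∀ t : T.Std l, dUpTo (t.concat (Nat.zero_le _) h p) j hjr
        = D * T.ι hj (dUpTo t s le_rfl) by
    have := H r h le_rfl
    rwa [p.finish] at this
  intro j hj
  induction j, hj using Nat.le_induction with
  | base =>
    intro hjr
    refine ⟨1, ⟨1, ?_⟩, fun t => ?_⟩
    · rw [p.start, T.ι_refl, mul_one, one_mul]
    · rw [T.ι_refl, one_mul]
      exact dUpTo_congr _ _ _ _ fun i hi => SkewTab.concat_v_of_le _ _ _ _ _ hi
  | succ j hj ih =>
    intro hjr
    obtain ⟨D, ⟨u, hu⟩, hD⟩ := ih (by omega)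
    obtain ⟨u', hu'⟩ := (p.edge j ⟨hj, by omega⟩ ⟨by omega, hjr⟩).compat
    refine ⟨T.d (p.v j ⟨hj, by omega⟩) (p.v (j + 1) ⟨by omega, hjr⟩) * T.ι (Nat.le_succ j) D,
      ⟨u' * T.ι (Nat.le_succ j) u, ?_⟩, fun t => ?_⟩
    · rw [← mul_assoc, hu', mul_assoc, ← map_mul, hu, map_mul, T.ι_trans, mul_assoc]
    · rw [dUpTo, hD, SkewTab.concat_v_of_ge _ _ _ _ _ hj, SkewTab.concat_v_of_ge _ _ _ _ _ (by omega),
        map_mul, T.ι_trans, mul_assoc]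

theorem exists_m_mul_dUpTo (t : T.Std n) (h : s ≤ r) :
    ∃ (u : A r) (x : A s), T.m n * dUpTo t r le_rfl =
      u * T.ι h (T.m (t.v s ⟨Nat.zero_le _, h⟩) * x) := by
  obtain ⟨D, ⟨u, hu⟩, hD⟩ := exists_dUpTo_concat h (t.drop (Nat.zero_le _) h)
  have := hD (t.take (Nat.zero_le _) h)
  rw [SkewTab.take_concat_drop] at this
  exact ⟨u, _, by rw [this, ← mul_assoc, hu, map_mul, mul_assoc]⟩

/-- The Murphy elements span the cell module. -/
theorem span_murphy (n : T.Idx r) :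
    Submodule.span R (Set.range (murphy : T.Std n → T.Cell n)) = ⊤ := by
  induction r with
  | zero =>
    obtain rfl := Subsingleton.elim T.root n
    rw [eq_top_iff]
    intro y _
    obtain ⟨a, rfl⟩ := T.δ_cyclic _ y
    obtain ⟨c, rfl⟩ := T.zero_eq.surjective a
    let t : T.Std T.root :=
      { v := fun i hi => cast (congrArg T.Idx (by omega : 0 = i)) T.root
        start := fun _ => rfl
        finish := fun _ => rfl
        edge := fun i h h' => absurd h'.2 (by omega) }
    have ht : murphy t = T.δ T.root := by
      change op (1 : A 0) • T.δ T.root = _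
      rw [MulOpposite.op_one, one_smul]
    have h1 : op (algebraMap R (A 0) c) • T.δ T.root = c • murphy t := by
      rw [ht, Algebra.algebraMap_eq_smul_one, MulOpposite.op_smul, smul_assoc, MulOpposite.op_one,
        one_smul]
    rw [h1]
    exact Submodule.smul_mem _ _ (Submodule.subset_span ⟨t, rfl⟩)
  | succ r ih =>
    refine eq_top_of_lift _ fun l e z => ?_
    have hz : z ∈ Submodule.span R (Set.range (murphy : T.Std l → T.Cell l)) := by
      rw [ih l]; trivial
    -- The representative `a` of `z` is free to choose. For a Murphy element it is d_t itself, whose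
    -- lift is the Murphy element of the path prolonged by the edge; the other cases combine such
    -- choices linearly.
    induction hz using Submodule.span_induction with
    | mem z hz =>
      obtain ⟨t, rfl⟩ := hz
      refine ⟨_, rfl, Submodule.subset_span
        ⟨t.concat (Nat.zero_le _) (Nat.le_succ r) (SkewTab.ofEdge e), ?_⟩⟩
      rw [murphy, dUpTo]
      have h1 : dUpTo (t.concat (Nat.zero_le _) (Nat.le_succ r) (SkewTab.ofEdge e)) r
          (Nat.le_succ r) = dUpTo t r le_rfl :=
        dUpTo_congr _ _ _ _ fun i hi => SkewTab.concat_v_of_le _ _ _ _ _ hi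
      rw [h1, SkewTab.finish, SkewTab.concat_v_of_le _ _ _ _ _ le_rfl, SkewTab.finish]
    | zero => exact ⟨0, by simp, by simp⟩
    | add y z _ _ hy hz =>
      obtain ⟨a, rfl, ha⟩ := hy
      obtain ⟨b, rfl, hb⟩ := hz
      refine ⟨a + b, by rw [MulOpposite.op_add, add_smul], ?_⟩
      rw [map_add, mul_add, MulOpposite.op_add, add_smul]
      exact Submodule.add_mem _ ha hb
    | smul c y _ hy =>
      obtain ⟨a, rfl, ha⟩ := hy
      refine ⟨c • a, by rw [MulOpposite.op_smul, smul_assoc], ?_⟩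
      rw [map_smul, mul_smul_comm, MulOpposite.op_smul, smul_assoc]
      exact Submodule.smul_mem _ _ ha

/-- Without paths the Murphy span would be zero, but a cell module is not. -/
instance (n : T.Idx r) : Nonempty (T.Std n) := by
  by_contra h
  rw [not_nonempty_iff] at h
  have h1 := span_murphy n
  rw [Set.range_eq_empty, Submodule.span_empty] at h1
  exact bot_ne_top h1

/-! ### The Gelfand--Zeitlin idempotents -/

theorem gzUpTo_congr (t : T.Std l) (t' : T.Std n) {k : ℕ} (hs : k ≤ s) (hr : k ≤ r)
    (h : ∀ i (hi : i ≤ k), t.v i ⟨Nat.zero_le _, hi.trans hs⟩ = t'.v i ⟨Nat.zero_le _, hi.trans hr⟩) :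
    gzUpTo t k hs = gzUpTo t' k hr := by
  induction k with
  | zero => rfl
  | succ k ih =>
    rw [gzUpTo, gzUpTo, ih (by omega) (by omega) fun i hi => h i (by omega), h (k + 1) le_rfl]

theorem exists_gzUpTo_eq_mul (t : T.Std n) {k j : ℕ} (h : k ≤ j) (hj : j ≤ r) :
    ∃ x, gzUpTo t j hj = T.ιF h (gzUpTo t k (h.trans hj)) * x := by
  induction j, h using Nat.le_induction with
  | base => exact ⟨1, by rw [T.ιF_refl, mul_one]⟩
  | succ j h ih =>
    obtain ⟨x, hx⟩ := ih (by omega)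
    exact ⟨_, by rw [gzUpTo, hx, map_mul, T.ιF_trans, mul_assoc]⟩

/-- Of two central idempotents at different levels, the lower one lies in the algebra in whose
centre the higher one lies. Hence all factors commute. -/
theorem centralIdem_mul_gzUpTo (t : T.Std n) {i k : ℕ} (h : i ≤ k) (hk : k ≤ r) (m : T.Idx i) :
    T.ιF h (T.centralIdem m) * gzUpTo t k hk = gzUpTo t k hk * T.ιF h (T.centralIdem m) := by
  induction k with
  | zero => rw [gzUpTo, mul_one, one_mul]
  | succ k ih =>
    rcases Nat.le_succ_iff.mp h with h1 | rfl
    · rw [gzUpTo, ← T.ιF_trans h1 (Nat.le_succ k), ← mul_assoc, ← map_mul, ih h1 (by omega),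
        map_mul, mul_assoc, mul_assoc, T.centralIdem_comm]
    · rw [T.ιF_refl, T.centralIdem_comm]

theorem gzUpTo_mul_centralIdem (t : T.Std n) {i k : ℕ} (h : i ≤ k) (hk : k ≤ r) :
    gzUpTo t k hk * T.ιF h (T.centralIdem (t.v i ⟨Nat.zero_le _, h.trans hk⟩)) =
      gzUpTo t k hk := by
  induction k with
  | zero =>
    obtain rfl : i = 0 := by omega
    rw [centralIdem_zero, map_one, mul_one]
  | succ k ih =>
    rcases Nat.le_succ_iff.mp h with h1 | rfl
    · rw [gzUpTo, mul_assoc, T.centralIdem_comm, ← mul_assoc, ← T.ιF_trans h1 (Nat.le_succ k),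
        ← map_mul, ih h1 (by omega)]
    · rw [T.ιF_refl, gzUpTo, mul_assoc, T.centralIdem_mul_self]

theorem gzUpTo_mul_self (t : T.Std n) {k : ℕ} (hk : k ≤ r) :
    gzUpTo t k hk * gzUpTo t k hk = gzUpTo t k hk := by
  induction k with
  | zero => rw [gzUpTo, mul_one]
  | succ k ih =>
    rw [gzUpTo, ← mul_assoc, mul_assoc (T.ιF _ _), T.centralIdem_comm, ← mul_assoc, ← map_mul, ih,
      mul_assoc, T.centralIdem_mul_self]

theorem gz_mul_self (t : T.Std n) : gz t * gz t = gz t := gzUpTo_mul_self t le_rfl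

theorem gz_mul_centralIdem (t : T.Std n) : gz t * T.centralIdem n = gz t := by
  have := gzUpTo_mul_centralIdem t le_rfl le_rfl
  rwa [T.ιF_refl, t.finish] at this

theorem gz_mul_gz_of_ne {t t' : T.Std n} (h : t ≠ t') : gz t * gz t' = 0 := by
  obtain ⟨i, hi, hne⟩ : ∃ i hi, t.v i hi ≠ t'.v i hi := by
    by_contra! hc
    exact h (SkewTab.ext (funext fun i => funext fun hi => hc i hi))
  have h1 := gzUpTo_mul_centralIdem t hi.2 le_rfl
  have h2 := gzUpTo_mul_centralIdem t' hi.2 le_rfl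
  rw [← centralIdem_mul_gzUpTo] at h2
  rw [gz, gz, ← h1, ← h2, mul_assoc, ← mul_assoc (T.ιF _ _), ← map_mul,
    T.centralIdem_mul_of_ne hne, map_zero, zero_mul, mul_zero]

variable [IsFractionRing R F]

/-- Dominance triangularity with respect to the central idempotents. -/
theorem centralIdem_smul_murphy (t : T.Std n) (h : s ≤ r) {k : T.Idx s}
    (hk : ¬ t.v s ⟨Nat.zero_le _, h⟩ ≤ k) :
    op (T.ιF h (T.centralIdem k)) • ((1 : F) ⊗ₜ[R] murphy t) = 0 := by
  have h1 := op_tmul_smul R F (A r) (T.Cell n) 1 1 (dUpTo t r le_rfl) (T.δ n)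
  rw [mul_one] at h1
  rw [murphy, ← h1, ← mul_smul, ← MulOpposite.op_mul]
  apply T.smul_δ_eq_zero
  obtain ⟨u, x, hu⟩ := exists_m_mul_dUpTo t h
  have h2 : (1 : F) ⊗ₜ[R] T.m n * (1 : F) ⊗ₜ[R] dUpTo t r le_rfl = (1 : F) ⊗ₜ[R] u *
      T.ιF h ((1 : F) ⊗ₜ[R] T.m (t.v s ⟨Nat.zero_le _, h⟩) * (1 : F) ⊗ₜ[R] x) := by
    simp only [Algebra.TensorProduct.tmul_mul_tmul, T.ιF_tmul, one_mul, hu]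
  rw [← mul_assoc, h2, mul_assoc, ← map_mul, T.m_mul_centralIdem hk, map_zero, mul_zero]

theorem gz_smul_murphy (t : T.Std n) (h : s ≤ r) (q : T.Std l) {i : ℕ} (hi : i ≤ s)
    (hk : ¬ t.v i ⟨Nat.zero_le _, hi.trans h⟩ ≤ q.v i ⟨Nat.zero_le _, hi⟩) :
    op (T.ιF h (gz q)) • ((1 : F) ⊗ₜ[R] murphy t) = 0 := by
  rw [gz, ← gzUpTo_mul_centralIdem q hi le_rfl, ← centralIdem_mul_gzUpTo, map_mul, T.ιF_trans,
    MulOpposite.op_mul, mul_smul, centralIdem_smul_murphy t (hi.trans h) hk, smul_zero]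

/-- Induction along the path. With denominators cleared, the partial product of idempotents is an
integral element `a` of A_k, and the vector δ d a of Δ(t(k)) is non-zero. The cell filtration keeps
it non-zero across the next edge, and the new factor z_{t(k+1)} acts as the identity on Δ(t(k+1)).
-/
theorem gz_smul_murphy_self_ne_zero (t : T.Std n) :
    op (gz t) • ((1 : F) ⊗ₜ[R] murphy t) ≠ 0 := by
  suffices H : ∀ k (hk : k ≤ r), op (gzUpTo t k hk) •
      ((1 : F) ⊗ₜ[R] (op (dUpTo t k hk) • T.δ (t.v k ⟨Nat.zero_le _, hk⟩))) ≠ 0 by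
    have := H r le_rfl
    rwa [t.finish] at this
  intro k
  induction k with
  | zero =>
    intro hk h0
    rw [gzUpTo, dUpTo, MulOpposite.op_one, MulOpposite.op_one, one_smul, one_smul] at h0
    exact T.δ_ne_zero _ ((T.cell 0).eq_zero_of_one_tmul_cell h0)
  | succ k ih =>
    intro hk
    have ihk := ih (by omega)
    obtain ⟨c, a, hc, ha⟩ := exists_smul_eq_one_tmul (gzUpTo t k (by omega))
    have h1 : op (dUpTo t k (by omega) * a) • T.δ (t.v k ⟨Nat.zero_le _, by omega⟩) ≠ 0 := by
      intro h0
      apply (smul_ne_zero hc ihk)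
      rw [← smul_assoc, ← MulOpposite.op_smul, ha, op_tmul_smul, ← mul_smul, ← MulOpposite.op_mul,
        h0, TensorProduct.tmul_zero]
    have h2 := (t.edge k ⟨Nat.zero_le _, by omega⟩ ⟨Nat.zero_le _, hk⟩).smul_δ_ne_zero h1
    intro h0
    apply h2
    rw [gzUpTo, MulOpposite.op_mul, mul_smul, T.centralIdem_smul] at h0
    apply (T.cell (k + 1)).eq_zero_of_one_tmul_cell (F := F)
    have h3 := congrArg (fun y => algebraMap R F c • y) h0
    simp only [smul_zero] at h3
    rw [← smul_assoc, ← MulOpposite.op_smul, ← map_smul, ha, T.ιF_tmul, op_tmul_smul, mul_one,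
      dUpTo, ← mul_smul, ← MulOpposite.op_mul, mul_assoc, ← map_mul] at h3
    exact h3

end Murphy

end DiagramTower

namespace DiagramTower

variable {R F : Type*} {A : ℕ → Type*} [CommRing R] [IsDomain R] [Field F] [Algebra R F]
  [∀ r, Ring (A r)] [∀ r, Algebra R (A r)] {T : DiagramTower R F A}
  {s r : ℕ} {l : T.Idx s} {n : T.Idx r}

/-! ### Spans of Murphy elements over upper sets of tableaux -/

theorem gz_smul_eq_zero_of_centralIdem (t : T.Std l) {i : ℕ} (hi : i ≤ s) (h : s ≤ r)
    {y : F ⊗[R] T.Cell n}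
    (hy : op (T.ιF (hi.trans h) (T.centralIdem (t.v i ⟨Nat.zero_le _, hi⟩))) • y = 0) :
    op (T.ιF h (gz t)) • y = 0 := by
  rw [gz, ← gzUpTo_mul_centralIdem t hi le_rfl, ← centralIdem_mul_gzUpTo, map_mul, T.ιF_trans,
    MulOpposite.op_mul, mul_smul, hy, smul_zero]

theorem gz_concat_smul_eq_zero (h : s ≤ r) (t : T.Std l) (p : T.SkewTab l n)
    {y : F ⊗[R] T.Cell n} (hy : op (T.ιF h (gz t)) • y = 0) :
    op (gz (t.concat (Nat.zero_le _) h p)) • y = 0 := by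
  obtain ⟨x, hx⟩ := exists_gzUpTo_eq_mul (t.concat (Nat.zero_le _) h p) h le_rfl
  have h1 : gzUpTo (t.concat (Nat.zero_le _) h p) s h = gz t :=
    gzUpTo_congr _ _ _ _ fun i hi => SkewTab.concat_v_of_le _ _ _ _ _ hi
  rw [gz, hx, h1, MulOpposite.op_mul, mul_smul, hy, smul_zero]

omit [IsDomain R] in
theorem op_smul_one_tmul_smul (b : F ⊗[R] A r) (c : R) (y : T.Cell n) :
    op b • ((1 : F) ⊗ₜ[R] (c • y)) = c • op b • ((1 : F) ⊗ₜ[R] y) := by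
  rw [TensorProduct.tmul_smul, ← algebraMap_smul F c, smul_comm, algebraMap_smul]

variable [IsFractionRing R F]

theorem gz_smul_murphy_of_not_le {t w : T.Std n} (h : ¬ t ≤ w) :
    op (gz w) • ((1 : F) ⊗ₜ[R] murphy t) = 0 := by
  obtain ⟨i, hi, hne⟩ : ∃ i hi, ¬ t.v i hi ≤ w.v i hi := by
    by_contra! hc
    exact h hc
  have := gz_smul_murphy t le_rfl w hi.2 hne
  rwa [T.ιF_refl] at this

/-- The argument for triangular systems. The family `g` makes it serve both for all tableaux and for
those of the form t ∘ p. -/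
theorem coeff_eq_zero_of_gz_smul {ι : Type*} [Fintype ι] {g : ι → T.Std n}
    (hg : Function.Injective g) {S : Set (T.Std n)} (hS : IsUpperSet S) {c : ι → R}
    (h : ∀ w ∉ S, op (gz w) • ((1 : F) ⊗ₜ[R] ∑ i, c i • murphy (g i)) = 0) {i : ι}
    (hi : g i ∉ S) : c i = 0 := by
  by_contra hci
  -- Take a dominance-minimal tableau outside `S` with non-zero coefficient. Its idempotent kills
  -- every term not below it, and the terms strictly below it are outside the upper set `S`, so by
  -- minimality they have zero coefficients.
  obtain ⟨j, ⟨hjS, hcj⟩, hmin⟩ := (Set.toFinite {i | g i ∉ S ∧ c i ≠ 0}).exists_minimalFor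
    g _ ⟨i, hi, hci⟩
  have h1 := h (g j) hjS
  rw [TensorProduct.tmul_sum, Finset.smul_sum, Finset.sum_eq_single j] at h1
  · rw [op_smul_one_tmul_smul, ← algebraMap_smul F] at h1
    exact smul_ne_zero (by simpa using hcj) (gz_smul_murphy_self_ne_zero (g j)) h1
  · intro k _ hkj
    rw [op_smul_one_tmul_smul]
    by_cases hk : g k ≤ g j
    · suffices c k = 0 by rw [this, zero_smul]
      by_contra hck
      exact hkj (hg (le_antisymm hk (hmin ⟨fun hkS => hjS (hS hk hkS), hck⟩ hk)))
    · rw [gz_smul_murphy_of_not_le hk, smul_zero]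
  · simp

/-- The bridge from `F` back to `R`: idempotents defined over `F` detect an integral span, because
they only force coefficients of an `R`-expansion to vanish and nothing is divided. -/
theorem mem_span_of_gz_smul {S : Set (T.Std n)} (hS : IsUpperSet S) {y : T.Cell n}
    (h : ∀ w ∉ S, op (gz w) • ((1 : F) ⊗ₜ[R] y) = 0) :
    y ∈ Submodule.span R (murphy '' S) := by
  have := Fintype.ofFinite (T.Std n)
  have hy : y ∈ Submodule.span R (Set.range (murphy : T.Std n → T.Cell n)) := by
    rw [span_murphy]; trivial
  obtain ⟨c, rfl⟩ := (Submodule.mem_span_range_iff_exists_fun R).mp hy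
  refine Submodule.sum_mem _ fun v _ => ?_
  by_cases hv : v ∈ S
  · exact Submodule.smul_mem _ _ (Submodule.subset_span ⟨v, hv, rfl⟩)
  · rw [coeff_eq_zero_of_gz_smul (g := id) Function.injective_id hS h hv, zero_smul]
    exact zero_mem _

omit [IsDomain R] [IsFractionRing R F] in
theorem smul_eq_zero_of_mem_span {b : F ⊗[R] A r} {X : Set (T.Cell n)}
    (h : ∀ x ∈ X, op b • ((1 : F) ⊗ₜ[R] x) = 0) {y : T.Cell n} (hy : y ∈ Submodule.span R X) :
    op b • ((1 : F) ⊗ₜ[R] y) = 0 := by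
  induction hy using Submodule.span_induction with
  | mem x hx => exact h x hx
  | zero => simp
  | add x y _ _ hx hy => rw [TensorProduct.tmul_add, smul_add, hx, hy, add_zero]
  | smul c x _ hx => rw [op_smul_one_tmul_smul, hx, smul_zero]

omit [IsFractionRing R F] in
theorem isUpperSet_above (h : s ≤ r) (l : T.Idx s) (n : T.Idx r) :
    IsUpperSet {w : T.Std n | l < w.v s ⟨Nat.zero_le _, h⟩} :=
  fun _ _ hvw hv => hv.trans_le (hvw s _)

omit [IsFractionRing R F] in
theorem spanAbove_eq (h : s ≤ r) (l : T.Idx s) (n : T.Idx r) : spanAbove h l n =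
    Submodule.span R (murphy '' {w : T.Std n | l < w.v s ⟨Nat.zero_le _, h⟩}) :=
  congrArg _ (Set.ext fun _ => ⟨fun ⟨t, ht, e⟩ => ⟨t, ht, e.symm⟩, fun ⟨t, ht, e⟩ => ⟨t, ht, e.symm⟩⟩)

/-- `Δ(n; ▷ l)` consists of the elements of `Δ(n)` supported on the isotypic components `k ▷ l`. -/
theorem mem_spanAbove_iff (h : s ≤ r) {y : T.Cell n} : y ∈ spanAbove h l n ↔
    ∀ k, ¬ l < k → op (T.ιF h (T.centralIdem k)) • ((1 : F) ⊗ₜ[R] y) = 0 := by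
  constructor
  · intro hy k hk
    refine smul_eq_zero_of_mem_span ?_ hy
    rintro _ ⟨t, ht, rfl⟩
    exact centralIdem_smul_murphy t h fun hle => hk (ht.trans_le hle)
  · intro hy
    rw [spanAbove_eq]
    refine mem_span_of_gz_smul (isUpperSet_above h l n) fun w hw => ?_
    have := gz_smul_eq_zero_of_centralIdem w h le_rfl (hy _ hw)
    rwa [T.ιF_refl] at this

/-- Maximality of `t` is used twice. It gives t ≰ q for q ≠ t, so F_q kills the Murphy elements
through `t`. It also makes the set of tableaux that pass through `t` or lie above `l` at level s an
upper set, so that the idempotent criterion applies. -/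
theorem mem_spanThrough_sup_iff (h : s ≤ r) {t : T.Std l} (ht : IsMax t) {y : T.Cell n} :
    y ∈ spanThrough h t n ⊔ spanAbove h l n ↔
      (∀ k, ¬ l ≤ k → op (T.ιF h (T.centralIdem k)) • ((1 : F) ⊗ₜ[R] y) = 0) ∧
      ∀ q : T.Std l, q ≠ t → op (T.ιF h (gz q)) • ((1 : F) ⊗ₜ[R] y) = 0 := by
  constructor
  · intro hy
    rw [spanThrough, spanAbove, ← Submodule.span_union] at hy
    refine ⟨fun k hk => smul_eq_zero_of_mem_span ?_ hy,
      fun q hq => smul_eq_zero_of_mem_span ?_ hy⟩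
    · rintro _ (⟨p, rfl⟩ | ⟨v, hv, rfl⟩)
      · refine centralIdem_smul_murphy _ h fun hle => hk ?_
        rwa [SkewTab.concat_v_of_le _ _ _ _ _ le_rfl, t.finish] at hle
      · exact centralIdem_smul_murphy v h fun hle => hk (hv.le.trans hle)
    · rintro _ (⟨p, rfl⟩ | ⟨v, hv, rfl⟩)
      · obtain ⟨i, hi, hne⟩ : ∃ i hi, ¬ t.v i hi ≤ q.v i hi := by
          by_contra! hc
          exact hq (le_antisymm (ht hc) hc)
        refine gz_smul_murphy _ h q hi.2 ?_
        rwa [SkewTab.concat_v_of_le _ _ _ _ _ hi.2]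
      · refine gz_smul_murphy v h q le_rfl ?_
        rw [q.finish]
        exact hv.not_ge
  · rintro ⟨h1, h2⟩
    have h3 : spanThrough h t n ⊔ spanAbove h l n = Submodule.span R (murphy ''
        {w | (∃ p, w = t.concat (Nat.zero_le _) h p) ∨ l < w.v s ⟨Nat.zero_le _, h⟩}) := by
      rw [spanThrough, spanAbove_eq, ← Submodule.span_union]
      congr 1
      ext y
      constructor
      · rintro (⟨p, rfl⟩ | ⟨v, hv, rfl⟩)
        · exact ⟨_, Or.inl ⟨p, rfl⟩, rfl⟩
        · exact ⟨_, Or.inr hv, rfl⟩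
      · rintro ⟨_, ⟨p, rfl⟩ | hv, rfl⟩
        · exact Or.inl ⟨p, rfl⟩
        · exact Or.inr ⟨_, hv, rfl⟩
    rw [h3]
    refine mem_span_of_gz_smul ?_ fun w hw => ?_
    · rintro v w hvw (⟨p, rfl⟩ | hv)
      · have h4 := hvw s ⟨Nat.zero_le _, h⟩
        rw [SkewTab.concat_v_of_le _ _ _ _ _ le_rfl, t.finish] at h4
        rcases h4.lt_or_eq with h5 | h5
        · exact Or.inr h5
        · obtain ⟨q, p', rfl⟩ := w.exists_concat_eq (Nat.zero_le _) h h5.symm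
          have h6 : t ≤ q := fun i hi => by
            have := hvw i ⟨hi.1, hi.2.trans h⟩
            rwa [SkewTab.concat_v_of_le _ _ _ _ _ hi.2, SkewTab.concat_v_of_le _ _ _ _ _ hi.2]
              at this
          exact Or.inl ⟨p', by rw [le_antisymm (ht h6) h6]⟩
      · exact Or.inr (hv.trans_le (hvw s _))
    · by_cases hl : l ≤ w.v s ⟨Nat.zero_le _, h⟩
      · rcases hl.lt_or_eq with h5 | h5
        · exact absurd (Or.inr h5) hw
        · obtain ⟨q, p, rfl⟩ := w.exists_concat_eq (Nat.zero_le _) h h5.symm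
          refine gz_concat_smul_eq_zero h q p (h2 q ?_)
          rintro rfl
          exact hw (Or.inl ⟨p, rfl⟩)
      · have := gz_smul_eq_zero_of_centralIdem w h le_rfl (h1 _ hl)
        rwa [T.ιF_refl] at this

/-! ### Stability under the commutant -/

omit [IsFractionRing R F] [IsDomain R] in
theorem ιF_mul_one_tmul (h : s ≤ r) (c : T.commutant h) (b : F ⊗[R] A s) :
    T.ιF h b * (1 : F) ⊗ₜ[R] (c : A r) = (1 : F) ⊗ₜ[R] (c : A r) * T.ιF h b := by
  induction b using TensorProduct.induction_on with
  | zero => simp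
  | add x y hx hy => rw [map_add, add_mul, mul_add, hx, hy]
  | tmul e a =>
    have := (Subalgebra.mem_centralizer_iff R).mp c.2 (T.ι h a) ⟨a, rfl⟩
    rw [T.ιF_tmul, Algebra.TensorProduct.tmul_mul_tmul, Algebra.TensorProduct.tmul_mul_tmul, this,
      one_mul, mul_one]

omit [IsFractionRing R F] [IsDomain R] in
theorem smul_one_tmul_smul (h : s ≤ r) (c : T.commutant h) (b : F ⊗[R] A s) (y : T.Cell n) :
    op (T.ιF h b) • ((1 : F) ⊗ₜ[R] (op (c : A r) • y)) =
      op ((1 : F) ⊗ₜ[R] (c : A r)) • op (T.ιF h b) • ((1 : F) ⊗ₜ[R] y) := by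
  have h1 := op_tmul_smul R F (A r) (T.Cell n) 1 1 (c : A r) y
  rw [mul_one] at h1
  rw [← h1, ← mul_smul, ← mul_smul, ← MulOpposite.op_mul, ← MulOpposite.op_mul,
    ιF_mul_one_tmul]

/-- The criterion for membership involves only right multiplication by elements of F ⊗ A_s, and
these commute with the commutant. The same argument serves for `throughStable`. -/
theorem aboveStable (h : s ≤ r) (l : T.Idx s) (n : T.Idx r) : AboveStable h l n := by
  intro c y hy
  refine (mem_spanAbove_iff h (y := op (c : A r) • (show T.Cell n from y))).mpr fun k hk => ?_
  rw [smul_one_tmul_smul, (mem_spanAbove_iff h).mp hy k hk, smul_zero]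

theorem throughStable (h : s ≤ r) (n : T.Idx r) {t : T.Std l} (ht : IsMax t) :
    ThroughStable h n t := by
  intro c y hy
  obtain ⟨h1, h2⟩ := (mem_spanThrough_sup_iff h ht).mp hy
  refine (mem_spanThrough_sup_iff h ht (y := op (c : A r) • (show T.Cell n from y))).mpr
    ⟨fun k hk => ?_, fun q hq => ?_⟩
  · rw [smul_one_tmul_smul, h1 k hk, smul_zero]
  · rw [smul_one_tmul_smul, h2 q hq, smul_zero]

/-! ### The seminormal realization of the skew cell module -/

theorem gz_smul_eq_zero_of_mem_spanAbove (h : s ≤ r) (t : T.Std l) {y : T.Cell n}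
    (hy : y ∈ spanAbove h l n) : op (T.ιF h (gz t)) • ((1 : F) ⊗ₜ[R] y) = 0 := by
  refine gz_smul_eq_zero_of_centralIdem t le_rfl h ?_
  rw [t.finish]
  exact (mem_spanAbove_iff h).mp hy l (lt_irrefl l)

/-- F_t is the only idempotent of shape `l` that need not kill Δ(n; t) + Δ(n; ▷ l). Once it does,
every F_w with w(s) not above `l` kills the vector. -/
theorem mem_spanAbove_of_gz_smul (h : s ≤ r) {t : T.Std l} (ht : IsMax t) {y : T.Cell n}
    (hy : y ∈ spanThrough h t n ⊔ spanAbove h l n)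
    (h0 : op (T.ιF h (gz t)) • ((1 : F) ⊗ₜ[R] y) = 0) : y ∈ spanAbove h l n := by
  rw [mem_spanThrough_sup_iff h ht] at hy
  rw [spanAbove_eq]
  refine mem_span_of_gz_smul (isUpperSet_above h l n) fun w hw => ?_
  by_cases hl : l ≤ w.v s ⟨Nat.zero_le _, h⟩
  · rcases hl.lt_or_eq with h5 | h5
    · exact absurd h5 hw
    · obtain ⟨q, p, rfl⟩ := w.exists_concat_eq (Nat.zero_le _) h h5.symm
      refine gz_concat_smul_eq_zero h q p ?_
      by_cases hq : q = t
      · rw [hq, h0]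
      · exact hy.2 q hq
  · have := gz_smul_eq_zero_of_centralIdem w h le_rfl (hy.1 _ hl)
    rwa [T.ιF_refl] at this

/-- The homomorphism `y ↦ y F_t` on the skew cell module. -/
def toGZ {h : s ≤ r} (hN : AboveStable h l n) {t : T.Std l} (hM : ThroughStable h n t) :
    SkewCell hN hM →ₗ[(T.commutant h)ᵐᵒᵖ] Res (T.commToF h) (F ⊗[R] T.Cell n) :=
  (hN.sub.submoduleOf hM.sub).liftQ
    { toFun := fun y => op (T.ιF h (gz t)) • ((1 : F) ⊗ₜ[R] (show T.Cell n from y.1))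
      map_add' := fun y z => (congrArg (op (T.ιF h (gz t)) • ·)
        (TensorProduct.tmul_add (1 : F) (show T.Cell n from y.1) (show T.Cell n from z.1))).trans
          (smul_add (op (T.ιF h (gz t))) ((1 : F) ⊗ₜ[R] (show T.Cell n from y.1))
            ((1 : F) ⊗ₜ[R] (show T.Cell n from z.1)))
      map_smul' := fun c y => smul_one_tmul_smul h (unop c) (gz t) (show T.Cell n from y.1) }
    (fun _ hy => gz_smul_eq_zero_of_mem_spanAbove h t hy)

section ToGZ

variable {h : s ≤ r} (hN : AboveStable h l n) {t : T.Std l} (hM : ThroughStable h n t)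

theorem toGZ_mk (y : hM.sub) : toGZ hN hM (Submodule.Quotient.mk y) =
    op (T.ιF h (gz t)) • ((1 : F) ⊗ₜ[R] (show T.Cell n from y.1)) := rfl

theorem toGZ_injective (ht : IsMax t) : Function.Injective (toGZ hN hM) := by
  rw [← LinearMap.ker_eq_bot, LinearMap.ker_eq_bot']
  intro y
  induction y using Submodule.Quotient.induction_on with
  | H y =>
    intro hy
    rw [Submodule.Quotient.mk_eq_zero]
    exact mem_spanAbove_of_gz_smul h ht y.2 hy

theorem mem_range_toGZ (y : F ⊗[R] T.Cell n) :
    (∃ x, toGZ hN hM x = y) ↔ y ∈ spanThroughGZ h t n := by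
  constructor
  · rintro ⟨x, rfl⟩
    induction x using Submodule.Quotient.induction_on with
    | H x =>
      obtain ⟨x, hx⟩ := x
      obtain ⟨a, ha, b, hb, rfl⟩ := Submodule.mem_sup.mp
        (show (show T.Cell n from x) ∈ spanThrough h t n ⊔ spanAbove h l n from hx)
      refine ⟨a, ha, ?_⟩
      rw [toGZ_mk]
      change op (T.ιF h (gz t)) • ((1 : F) ⊗ₜ[R] a) =
        op (T.ιF h (gz t)) • ((1 : F) ⊗ₜ[R] (a + b))
      rw [TensorProduct.tmul_add, smul_add, gz_smul_eq_zero_of_mem_spanAbove h t hb, add_zero]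
  · rintro ⟨a, ha, rfl⟩
    exact ⟨Submodule.Quotient.mk ⟨a, (le_sup_left : spanThrough h t n ≤ _) ha⟩, rfl⟩

include hN hM in
theorem spanThroughGZ_stable : IsStable (T.commutant h)
    (N := Res (T.commToF h) (F ⊗[R] T.Cell n)) (spanThroughGZ h t n) := by
  intro c y hy
  obtain ⟨x, rfl⟩ := (mem_range_toGZ hN hM _).mpr hy
  refine (mem_range_toGZ hN hM _).mp ⟨op c • x, ?_⟩
  rw [map_smul]

end ToGZ

/-- Injective linear maps with equal ranges have isomorphic sources. -/
theorem nonempty_equiv_of_range_eq {S M M' N : Type*} [Ring S] [AddCommGroup M] [AddCommGroup M']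
    [AddCommGroup N] [Module S M] [Module S M'] [Module S N] {f : M →ₗ[S] N} {g : M' →ₗ[S] N}
    (hf : Function.Injective f) (hg : Function.Injective g)
    (h : LinearMap.range f = LinearMap.range g) : Nonempty (M ≃ₗ[S] M') :=
  ⟨(LinearEquiv.ofInjective f hf).trans
    ((LinearEquiv.ofEq _ _ h).trans (LinearEquiv.ofInjective g hg).symm)⟩

theorem skewCell_equiv_gz {h : s ≤ r} (hN : AboveStable h l n) {t : T.Std l}
    (hM : ThroughStable h n t) (ht : IsMax t) :
    ∃ hP : IsStable (T.commutant h) (N := Res (T.commToF h) (F ⊗[R] T.Cell n))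
        (spanThroughGZ h t n),
      Nonempty (SkewCell hN hM ≃ₗ[(T.commutant h)ᵐᵒᵖ] hP.sub) := by
  refine ⟨spanThroughGZ_stable hN hM, nonempty_equiv_of_range_eq (toGZ_injective hN hM ht)
    (Submodule.subtype_injective _) ?_⟩
  rw [Submodule.range_subtype]
  ext y
  exact mem_range_toGZ hN hM y

/-- The basis of the skew cell module. -/
theorem exists_basis_skewCell {h : s ≤ r} (hN : AboveStable h l n) {t : T.Std l}
    (hM : ThroughStable h n t) (ht : IsMax t) :
    ∃ b : Module.Basis (T.SkewTab l n) R (SkewCell hN hM), ∀ p, b p = skewMurphy hN hM p := by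
  have := Fintype.ofFinite (T.SkewTab l n)
  have hli : LinearIndependent R (skewMurphy hN hM) := by
    rw [Fintype.linearIndependent_iff]
    intro c hc p
    let y : T.Cell n := ∑ p, c p • murphy (t.concat (Nat.zero_le _) h p)
    have h1 : op (T.ιF h (gz t)) • ((1 : F) ⊗ₜ[R] y) = 0 := by
      have h2 := congrArg (toGZ hN hM) hc
      rw [map_sum, map_zero] at h2
      refine Eq.trans ?_ h2
      rw [TensorProduct.tmul_sum, Finset.smul_sum]
      refine Finset.sum_congr rfl fun p _ => ?_
      rw [LinearMap.map_smul_of_tower, op_smul_one_tmul_smul]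
      rfl
    have h2 : y ∈ spanAbove h l n := mem_spanAbove_of_gz_smul h ht
      ((le_sup_left : spanThrough h t n ≤ _) (Submodule.sum_mem _ fun p _ =>
        Submodule.smul_mem _ _ (Submodule.subset_span ⟨p, rfl⟩))) h1
    -- The paths t ∘ p pass through `l` itself, so they lie outside the upper set that spans Δ(n; ▷
    -- l), and their coefficients must vanish.
    refine coeff_eq_zero_of_gz_smul (t.concat_left_injective (Nat.zero_le _) h)
      (isUpperSet_above h l n) (fun w hw => ?_) (i := p) ?_
    · have := gz_smul_eq_zero_of_centralIdem w h le_rfl ((mem_spanAbove_iff h).mp h2 _ hw)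
      rwa [T.ιF_refl] at this
    · change ¬ l < (t.concat (Nat.zero_le _) h p).v s ⟨Nat.zero_le _, h⟩
      rw [SkewTab.concat_v_of_le _ _ _ _ _ le_rfl, t.finish]
      exact lt_irrefl l
  have hsp : ⊤ ≤ Submodule.span R (Set.range (skewMurphy hN hM)) := by
    intro x _
    obtain ⟨a, ha, hx⟩ := (mem_range_toGZ hN hM _).mp ⟨x, rfl⟩
    -- Since `toGZ` is injective, it suffices to find an element of the span with the same image,
    -- and the image comes from Δ(n; t).
    suffices H : ∃ z ∈ Submodule.span R (Set.range (skewMurphy hN hM)),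
        toGZ hN hM z = op (T.ιF h (gz t)) • ((1 : F) ⊗ₜ[R] a) by
      obtain ⟨z, hz, hz'⟩ := H
      rwa [← toGZ_injective hN hM ht (hz'.trans hx)]
    clear hx
    induction ha using Submodule.span_induction with
    | mem a ha =>
      obtain ⟨p, rfl⟩ := ha
      exact ⟨_, Submodule.subset_span ⟨p, rfl⟩, rfl⟩
    | zero => exact ⟨0, zero_mem _, by rw [map_zero, TensorProduct.tmul_zero, smul_zero]; rfl⟩
    | add a b _ _ ha hb =>
      obtain ⟨y, hy, hy'⟩ := ha
      obtain ⟨z, hz, hz'⟩ := hb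
      exact ⟨y + z, Submodule.add_mem _ hy hz, by
        rw [map_add, hy', hz', TensorProduct.tmul_add, smul_add]; rfl⟩
    | smul c a _ ha =>
      obtain ⟨y, hy, hy'⟩ := ha
      refine ⟨c • y, Submodule.smul_mem _ _ hy, ?_⟩
      rw [LinearMap.map_smul_of_tower, hy']
      exact (op_smul_one_tmul_smul _ c a).symm
  exact ⟨Module.Basis.mk hli hsp, fun p => Module.Basis.mk_apply hli hsp p⟩

end DiagramTower

/-- Irreducibility of F ⊗ Δ(l): the algebra surjects onto the full matrix block, and a matrix of
rank one, built from a non-zero coordinate of `x`, sends `x` to `y`. -/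
theorem CellDatum.exists_smul_eq {R A : Type*} [CommRing R] [Ring A] [Algebra R A]
    (D : CellDatum R A) {F : Type*} [Field F] [Algebra R F]
    (hF : IsSplitSemisimple F (F ⊗[R] A)) {l : D.Idx} {x : F ⊗[R] D.Cell l} (hx : x ≠ 0)
    (y : F ⊗[R] D.Cell l) : ∃ a : F ⊗[R] A, op a • x = y := by
  classical
  obtain ⟨i, hi⟩ := Function.ne_iff.mp ((D.coord F l).map_ne_zero_iff.mpr hx)
  obtain ⟨a, ha⟩ := (D.matF_bijective hF).2
    (Pi.single l (Matrix.vecMulVec (Pi.single i (D.coord F l x i)⁻¹) (D.coord F l y)))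
  refine ⟨a, (D.coord F l).injective ?_⟩
  rw [D.coord_smul, ha, Pi.single_eq_same, Matrix.vecMul_vecMulVec, dotProduct_single,
    mul_inv_cancel₀ hi, one_smul]

/-- Restriction of an isomorphism along a homomorphism of algebras. -/
def Res.congr {R A B N N' : Type*} [CommRing R] [Ring A] [Algebra R A] [Ring B] [Algebra R B]
    [AddCommGroup N] [AddCommGroup N'] [Module Bᵐᵒᵖ N] [Module Bᵐᵒᵖ N'] (f : A →ₐ[R] B)
    (e : N ≃ₗ[Bᵐᵒᵖ] N') : Res f N ≃ₗ[Aᵐᵒᵖ] Res f N' :=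
  { e.toAddEquiv with map_smul' := fun a y => e.map_smul (op (f (unop a))) y }

/-- The extension of scalars of a homomorphism of right modules. -/
theorem liftBaseChange_op_smul {R F B C M N : Type*} [CommRing R] [CommRing F] [Algebra R F]
    [Ring B] [Algebra R B] [Algebra F B] [Ring C] [Algebra R C] [AddCommGroup M] [Module R M]
    [Module Cᵐᵒᵖ M] [IsScalarTower R Cᵐᵒᵖ M] [AddCommGroup N] [Module R N] [Module F N]
    [IsScalarTower R F N] [Module Bᵐᵒᵖ N] [IsScalarTower F Bᵐᵒᵖ N] (g : M →ₗ[R] N)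
    (φ : F ⊗[R] C →ₐ[F] B) (hg : ∀ k y, g (op k • y) = op (φ (1 ⊗ₜ k)) • g y) (c : F ⊗[R] C)
    (x : F ⊗[R] M) : g.liftBaseChange F (op c • x) = op (φ c) • g.liftBaseChange F x := by
  induction c using TensorProduct.induction_on with
  | zero => simp
  | add c c' hc hc' =>
    rw [MulOpposite.op_add, add_smul, map_add, hc, hc', map_add, MulOpposite.op_add, add_smul]
  | tmul e k =>
    induction x using TensorProduct.induction_on with
    | zero => simp
    | add x y hx hy => rw [smul_add, map_add, hx, hy, map_add, smul_add]
    | tmul f y =>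
      have h1 : φ (e ⊗ₜ k) = e • φ (1 ⊗ₜ k) := by
        rw [← map_smul, TensorProduct.smul_tmul', smul_eq_mul, mul_one]
      have h2 : op (φ (1 ⊗ₜ k)) • f • g y = f • op (φ (1 ⊗ₜ k)) • g y := by
        rw [← one_smul Bᵐᵒᵖ (g y), ← smul_assoc f, ← mul_smul, ← mul_smul, ← smul_assoc f,
          mul_smul_comm, mul_one]
      rw [op_tmul_smul, LinearMap.liftBaseChange_tmul, LinearMap.liftBaseChange_tmul, hg, h1,
        MulOpposite.op_smul, smul_assoc, h2, smul_smul, mul_comm e f]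

namespace DiagramTower

variable {R F : Type*} {A : ℕ → Type*} [CommRing R] [IsDomain R] [Field F] [Algebra R F]
  [∀ r, Ring (A r)] [∀ r, Algebra R (A r)] {T : DiagramTower R F A}
  {s r : ℕ} {l : T.Idx s} {n : T.Idx r}

/-! ### Seminormal vectors and the transport between Gelfand--Zeitlin idempotents -/

/-- The seminormal vector `m_t F_t`. -/
def seminormal (t : T.Std l) : F ⊗[R] T.Cell l := op (gz t) • ((1 : F) ⊗ₜ[R] murphy t)

theorem gz_smul_gz_smul (h : s ≤ r) (t : T.Std l) (y : F ⊗[R] T.Cell n) :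
    op (T.ιF h (gz t)) • op (T.ιF h (gz t)) • y = op (T.ιF h (gz t)) • y := by
  rw [← mul_smul, ← MulOpposite.op_mul, ← map_mul, gz_mul_self]

theorem gz_smul_seminormal (t : T.Std l) : op (gz t) • seminormal t = seminormal t := by
  rw [seminormal, ← mul_smul, ← MulOpposite.op_mul, gz_mul_self]

/-- An element of `F ⊗ A s` that maps the image of `F_t` to the image of `F_q`. -/
structure IsTransport (t q : T.Std l) (a : F ⊗[R] A s) : Prop where
  gz_mul : gz t * a = a
  mul_gz : a * gz q = a
  smul_seminormal : op a • seminormal t = seminormal q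

variable [IsFractionRing R F]

/-- F_q acts on F ⊗ Δ(l) with image in a line. By orthogonality every other F_w kills y F_q, so a
multiple of it lies in the span of the m_v with v ≥ q, and m_v F_q = 0 unless v ≤ q. -/
theorem exists_gz_smul_eq (q : T.Std l) (y : F ⊗[R] T.Cell l) :
    ∃ c : F, op (gz q) • y = c • seminormal q := by
  obtain ⟨c, z, hc, hz⟩ := exists_smul_eq_one_tmul (op (gz q) • y)
  have h1 : z ∈ Submodule.span R (murphy '' Set.Ici q) := by
    refine mem_span_of_gz_smul (isUpperSet_Ici q) fun w hw => ?_
    have hqw : q ≠ w := fun e => hw (by rw [e]; exact Set.self_mem_Ici)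
    rw [← hz, smul_comm, ← mul_smul (op (gz w)), ← MulOpposite.op_mul, gz_mul_gz_of_ne hqw,
      MulOpposite.op_zero, zero_smul, smul_zero]
  have h2 : ∃ e : F, op (gz q) • ((1 : F) ⊗ₜ[R] z) = e • seminormal q := by
    clear hz
    induction h1 using Submodule.span_induction with
    | mem z hz =>
      obtain ⟨v, hv, rfl⟩ := hz
      by_cases hvq : v ≤ q
      · rw [le_antisymm hvq hv]
        exact ⟨1, (one_smul _ _).symm⟩
      · exact ⟨0, by rw [gz_smul_murphy_of_not_le hvq, zero_smul]⟩
    | zero => exact ⟨0, by simp⟩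
    | add x y _ _ hx hy =>
      obtain ⟨e, he⟩ := hx
      obtain ⟨e', he'⟩ := hy
      exact ⟨e + e', by rw [TensorProduct.tmul_add, smul_add, he, he', add_smul]⟩
    | smul k x _ hx =>
      obtain ⟨e, he⟩ := hx
      exact ⟨algebraMap R F k * e, by
        rw [op_smul_one_tmul_smul, he, mul_smul, algebraMap_smul]⟩
  obtain ⟨e, he⟩ := h2
  rw [← hz, smul_comm, ← mul_smul, ← MulOpposite.op_mul, gz_mul_self] at he
  exact ⟨(algebraMap R F c)⁻¹ * e, by rw [mul_smul, ← he, inv_smul_smul₀ hc]⟩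

/-- Irreducibility moves the non-zero vector m_t F_t to m_q F_q. Multiplying by F_t on the left and
by F_q on the right does not disturb this. -/
theorem exists_isTransport (t q : T.Std l) : ∃ a, IsTransport t q a := by
  obtain ⟨a, ha⟩ := (T.cell s).exists_smul_eq (T.split s) (gz_smul_murphy_self_ne_zero t)
    (seminormal q)
  refine ⟨gz t * a * gz q, ?_, ?_, ?_⟩
  · rw [← mul_assoc, ← mul_assoc, gz_mul_self]
  · rw [mul_assoc, gz_mul_self]
  · rw [MulOpposite.op_mul, MulOpposite.op_mul, mul_smul, mul_smul, gz_smul_seminormal, seminormal,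
      ha, gz_smul_seminormal]

/-- On F ⊗ Δ(l) both sides factor through the line of m_t F_t and agree there. On the other cell
modules both act by zero, since they absorb z_l. -/
theorem IsTransport.mul_eq {t q : T.Std l} {a b : F ⊗[R] A s} (ha : IsTransport t q a)
    (hb : IsTransport q t b) : a * b = gz t := by
  apply (T.cell s).matF_injective (T.split s)
  funext k
  by_cases hk : k = l
  · subst hk
    refine (T.cell s).matF_eq_of_smul_eq F fun y => ?_
    obtain ⟨c, hc⟩ := exists_gz_smul_eq t y
    rw [← ha.gz_mul, MulOpposite.op_mul, MulOpposite.op_mul, mul_smul, mul_smul, hc, smul_comm (op a) c,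
      ha.smul_seminormal, smul_comm (op b) c, hb.smul_seminormal]
  · classical
    rw [← hb.mul_gz, ← gz_mul_centralIdem t, ← mul_assoc, ← mul_assoc]
    simp only [map_mul, Pi.mul_apply, T.matF_centralIdem_of_ne hk, mul_zero]

/-- Compatibility of the transport with the Murphy elements of concatenated paths. -/
theorem IsTransport.smul_murphy_concat (h : s ≤ r) {t q : T.Std l} {a : F ⊗[R] A s}
    (ha : IsTransport t q a) (p : T.SkewTab l n) :
    op (T.ιF h a) • ((1 : F) ⊗ₜ[R] murphy (t.concat (Nat.zero_le _) h p)) =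
      op (T.ιF h (gz q)) • ((1 : F) ⊗ₜ[R] murphy (q.concat (Nat.zero_le _) h p)) := by
  obtain ⟨D, ⟨u, hu⟩, hD⟩ := exists_dUpTo_concat h p
  have hm : ∀ {j : ℕ} {k : T.Idx j} (v : T.Std k), (1 : F) ⊗ₜ[R] murphy v =
      op ((1 : F) ⊗ₜ[R] dUpTo v j le_rfl) • ((1 : F) ⊗ₜ[R] T.δ k) := by
    intro j k v
    have h1 := op_tmul_smul R F (A j) (T.Cell k) 1 1 (dUpTo v j le_rfl) (T.δ k)
    rw [mul_one] at h1
    exact h1.symm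
  -- The vector δ_l b is the difference of m_t a and m_q F_q in F ⊗ Δ(l), hence zero. Because b z_l
  -- = b, the product m_l b vanishes exactly and not merely modulo the higher ideal, and m_n D = u
  -- m_l carries this up to level r.
  let b : F ⊗[R] A s := (1 : F) ⊗ₜ[R] dUpTo t s le_rfl * a - (1 : F) ⊗ₜ[R] dUpTo q s le_rfl * gz q
  have hb0 : op b • ((1 : F) ⊗ₜ[R] T.δ l) = 0 := by
    rw [MulOpposite.op_sub, sub_smul, MulOpposite.op_mul, MulOpposite.op_mul, mul_smul, mul_smul,
      ← hm, ← hm, sub_eq_zero]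
    refine Eq.trans ?_ ha.smul_seminormal
    rw [seminormal, ← mul_smul, ← MulOpposite.op_mul, ha.gz_mul]
  have hbz : b * T.centralIdem l = b := by
    have haz : a * T.centralIdem l = a := by rw [← ha.mul_gz, mul_assoc, gz_mul_centralIdem]
    simp only [b, sub_mul, mul_assoc, gz_mul_centralIdem, haz]
  have h1 := T.m_mul_mul_centralIdem hb0
  rw [mul_assoc, hbz] at h1
  have h2 : (1 : F) ⊗ₜ[R] T.m n * ((1 : F) ⊗ₜ[R] D * T.ιF h b) = 0 := by
    have h3 : (1 : F) ⊗ₜ[R] T.m n * (1 : F) ⊗ₜ[R] D =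
        (1 : F) ⊗ₜ[R] u * T.ιF h ((1 : F) ⊗ₜ[R] T.m l) := by
      rw [T.ιF_tmul, Algebra.TensorProduct.tmul_mul_tmul, Algebra.TensorProduct.tmul_mul_tmul, hu]
    rw [← mul_assoc, h3, mul_assoc, ← map_mul, h1, map_zero, mul_zero]
  have h4 := T.smul_δ_eq_zero h2
  have h5 : (1 : F) ⊗ₜ[R] D * T.ιF h b =
      (1 : F) ⊗ₜ[R] dUpTo (t.concat (Nat.zero_le _) h p) r le_rfl * T.ιF h a -
        (1 : F) ⊗ₜ[R] dUpTo (q.concat (Nat.zero_le _) h p) r le_rfl * T.ιF h (gz q) := by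
    rw [hD, hD, map_sub, map_mul, map_mul, T.ιF_tmul, T.ιF_tmul, mul_sub, ← mul_assoc,
      ← mul_assoc, Algebra.TensorProduct.tmul_mul_tmul, Algebra.TensorProduct.tmul_mul_tmul,
      one_mul]
  rw [h5, MulOpposite.op_sub, sub_smul, MulOpposite.op_mul, MulOpposite.op_mul, mul_smul, mul_smul,
    ← hm, ← hm, sub_eq_zero] at h4
  exact h4

theorem IsTransport.exists_smul_eq (h : s ≤ r) {t q : T.Std l} {a : F ⊗[R] A s}
    (ha : IsTransport t q a) {y : T.Cell n} (hy : y ∈ spanThrough h t n) :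
    ∃ y' ∈ spanThrough h q n, op (T.ιF h a) • ((1 : F) ⊗ₜ[R] y) =
      op (T.ιF h (gz q)) • ((1 : F) ⊗ₜ[R] y') := by
  induction hy using Submodule.span_induction with
  | mem y hy =>
    obtain ⟨p, rfl⟩ := hy
    exact ⟨_, Submodule.subset_span ⟨p, rfl⟩, ha.smul_murphy_concat h p⟩
  | zero => exact ⟨0, zero_mem _, by simp⟩
  | add x y _ _ hx hy =>
    obtain ⟨x', hx, hx'⟩ := hx
    obtain ⟨y', hy, hy'⟩ := hy
    exact ⟨x' + y', Submodule.add_mem _ hx hy, by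
      rw [TensorProduct.tmul_add, TensorProduct.tmul_add, smul_add, smul_add, hx', hy']⟩
  | smul c x _ hx =>
    obtain ⟨x', hx, hx'⟩ := hx
    exact ⟨c • x', Submodule.smul_mem _ _ hx, by
      rw [op_smul_one_tmul_smul, op_smul_one_tmul_smul, hx']⟩

/-! ### Independence of the maximal tableau -/

/-- Right multiplication by an element of `F ⊗ A s` commutes with the action of `A_r ∩ A_s'`. -/
def mulRight (h : s ≤ r) (n : T.Idx r) (a : F ⊗[R] A s) :
    Res (T.commToF h) (F ⊗[R] T.Cell n) →ₗ[(T.commutant h)ᵐᵒᵖ]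
      Res (T.commToF h) (F ⊗[R] T.Cell n) where
  toFun y := op (T.ιF h a) • (show F ⊗[R] T.Cell n from y)
  map_add' y z := smul_add (op (T.ιF h a)) (show F ⊗[R] T.Cell n from y) z
  map_smul' c y := by
    change op (T.ιF h a) • op ((1 : F) ⊗ₜ[R] ((unop c : T.commutant h) : A r)) •
        (show F ⊗[R] T.Cell n from y) =
      op ((1 : F) ⊗ₜ[R] ((unop c : T.commutant h) : A r)) • op (T.ιF h a) •
        (show F ⊗[R] T.Cell n from y)
    rw [← mul_smul, ← mul_smul, ← MulOpposite.op_mul, ← MulOpposite.op_mul, ιF_mul_one_tmul]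

section Transport

variable {h : s ≤ r} (hN : AboveStable h l n) {t : T.Std l} (hM : ThroughStable h n t)

theorem gz_smul_toGZ (x : SkewCell hN hM) :
    op (T.ιF h (gz t)) • (show F ⊗[R] T.Cell n from toGZ hN hM x) = toGZ hN hM x := by
  induction x using Submodule.Quotient.induction_on with
  | H x => exact gz_smul_gz_smul h t _

theorem IsTransport.mulRight_injective (ht : IsMax t) {q : T.Std l} {a : F ⊗[R] A s}
    (ha : IsTransport t q a) : Function.Injective ((mulRight h n a).comp (toGZ hN hM)) := by
  obtain ⟨b, hb⟩ := exists_isTransport q t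
  intro x y hxy
  apply toGZ_injective hN hM ht
  have h1 : ∀ x, op (T.ιF h b) • (show F ⊗[R] T.Cell n from
      (mulRight h n a).comp (toGZ hN hM) x) = toGZ hN hM x := by
    intro x
    refine Eq.trans ?_ (gz_smul_toGZ hN hM x)
    change op (T.ιF h b) • op (T.ιF h a) • (show F ⊗[R] T.Cell n from toGZ hN hM x) = _
    rw [← mul_smul, ← MulOpposite.op_mul, ← map_mul, ha.mul_eq hb]
  rw [← h1, ← h1, hxy]

/-- Inside F ⊗ Δ(n), multiplication by the transport from `t` to `q` maps Δ(n; t) F_t into Δ(n; q)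
F_q. The transport back does the converse and is inverse to it, so the two integral forms are
matched exactly. -/
theorem skewCell_equiv (ht : IsMax t) {q : T.Std l} (hM' : ThroughStable h n q) (hq : IsMax q) :
    Nonempty (SkewCell hN hM ≃ₗ[(T.commutant h)ᵐᵒᵖ] SkewCell hN hM') := by
  obtain ⟨a, ha⟩ := exists_isTransport t q
  obtain ⟨b, hb⟩ := exists_isTransport q t
  refine nonempty_equiv_of_range_eq (ha.mulRight_injective hN hM ht) (toGZ_injective hN hM' hq) ?_
  have hgz : ∀ y : T.Cell n, op (T.ιF h a) • op (T.ιF h (gz t)) • ((1 : F) ⊗ₜ[R] y) =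
      op (T.ιF h a) • ((1 : F) ⊗ₜ[R] y) := fun y => by
    rw [← mul_smul, ← MulOpposite.op_mul, ← map_mul, ha.gz_mul]
  apply le_antisymm
  · rintro _ ⟨x, rfl⟩
    obtain ⟨y, hy, hyx⟩ := (mem_range_toGZ hN hM _).mp ⟨x, rfl⟩
    obtain ⟨y', hy', h1⟩ := ha.exists_smul_eq h hy
    refine (mem_range_toGZ hN hM' _).mpr ⟨y', hy', ?_⟩
    refine h1.symm.trans ((hgz y).symm.trans ?_)
    exact congrArg (fun y : F ⊗[R] T.Cell n => op (T.ιF h a) • y) hyx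
  · rintro _ ⟨x, rfl⟩
    obtain ⟨y', hy', hyx⟩ := (mem_range_toGZ hN hM' _).mp ⟨x, rfl⟩
    obtain ⟨y, hy, h1⟩ := hb.exists_smul_eq h hy'
    obtain ⟨z, hz⟩ := (mem_range_toGZ hN hM (op (T.ιF h (gz t)) • ((1 : F) ⊗ₜ[R] y))).mpr
      ⟨y, hy, rfl⟩
    refine ⟨z, Eq.trans ?_ hyx⟩
    refine (congrArg (fun y : F ⊗[R] T.Cell n => op (T.ιF h a) • y) (hz.trans h1.symm)).trans ?_
    change op (T.ιF h a) • op (T.ιF h b) • ((1 : F) ⊗ₜ[R] y') =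
      op (T.ιF h (gz q)) • ((1 : F) ⊗ₜ[R] y')
    rw [← mul_smul, ← MulOpposite.op_mul, ← map_mul, hb.mul_eq ha]

/-! ### Extension of scalars -/

omit [IsFractionRing R F] in
theorem cellGZ_stable (h : s ≤ r) (q : T.Std l) (n : T.Idx r) :
    IsStable (T.commutantF h) (N := T.CommCellF h n) (cellGZ h q n) := by
  rintro c _ ⟨y, rfl⟩
  refine ⟨op (c : F ⊗[R] A r) • y, ?_⟩
  change op (T.ιF h (gz q)) • op (c : F ⊗[R] A r) • y =
    op (c : F ⊗[R] A r) • op (T.ιF h (gz q)) • y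
  rw [← mul_smul, ← mul_smul, ← MulOpposite.op_mul, ← MulOpposite.op_mul,
    (Subalgebra.mem_centralizer_iff F).mp c.2 _ ⟨_, rfl⟩]

/-- The `F`-linear map `e ⊗ y ↦ e (y F_t a)` on `F ⊗ Δ(n ∖ l)`. -/
def extGZ (a : F ⊗[R] A s) : F ⊗[R] SkewCell hN hM →ₗ[F] F ⊗[R] T.Cell n :=
  let g : SkewCell hN hM →ₗ[R] F ⊗[R] T.Cell n :=
    ((mulRight h n a).comp (toGZ hN hM)).restrictScalars R
  g.liftBaseChange F

theorem extGZ_tmul (a : F ⊗[R] A s) (e : F) (x : SkewCell hN hM) :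
    extGZ hN hM a (e ⊗ₜ x) = e • (show F ⊗[R] T.Cell n from
      (mulRight h n a).comp (toGZ hN hM) x) :=
  LinearMap.liftBaseChange_tmul _ _ _ _

theorem extGZ_smul (a : F ⊗[R] A s) (c : F ⊗[R] T.commutant h) (x : F ⊗[R] SkewCell hN hM) :
    extGZ hN hM a (op c • x) = op (T.commExt h c : F ⊗[R] A r) • extGZ hN hM a x :=
  liftBaseChange_op_smul _ ((T.commutantF h).val.comp (T.commExt h))
    (fun k y => map_smul ((mulRight h n a).comp (toGZ hN hM)) (op k) y) c x

/-- The homomorphism `e ⊗ y ↦ e (y F_t a)` of modules over the commutant. -/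
def extGZHom (a : F ⊗[R] A s) :
    SkewCellF hN hM →ₗ[(T.commutantF h)ᵐᵒᵖ] T.CommCellF h n where
  toFun x := extGZ hN hM a x
  map_add' x y := map_add (extGZ hN hM a) x y
  map_smul' c x := by
    refine (extGZ_smul hN hM a ((T.commExtEquiv h).symm (unop c)) x).trans ?_
    have h1 : T.commExt h ((T.commExtEquiv h).symm (unop c)) = unop c :=
      (T.commExtEquiv h).apply_symm_apply (unop c)
    rw [h1]
    rfl

theorem extGZ_injective (ht : IsMax t) {q : T.Std l} {a : F ⊗[R] A s} (ha : IsTransport t q a) :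
    Function.Injective (extGZ hN hM a) := by
  rw [injective_iff_map_eq_zero]
  intro x hx
  obtain ⟨c, y, hc, hy⟩ := exists_smul_eq_one_tmul x
  have h1 : extGZ hN hM a ((1 : F) ⊗ₜ y) = 0 := by rw [← hy, map_smul, hx, smul_zero]
  rw [extGZ_tmul, one_smul] at h1
  have h2 : y = 0 := ha.mulRight_injective hN hM ht (h1.trans (map_zero _).symm)
  rw [h2, TensorProduct.tmul_zero] at hy
  exact (smul_eq_zero_iff_right hc).mp hy

/-- Only `t` has to be maximal: transports exist between any two tableaux of shape `l`. -/
theorem range_extGZ (ht : IsMax t) {q : T.Std l} {a : F ⊗[R] A s} (ha : IsTransport t q a) :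
    LinearMap.range (extGZ hN hM a) = cellGZ h q n := by
  obtain ⟨b, hb⟩ := exists_isTransport q t
  apply le_antisymm
  · rintro _ ⟨x, rfl⟩
    induction x using TensorProduct.induction_on with
    | zero => rw [map_zero]; exact zero_mem _
    | add x y hx hy => rw [map_add]; exact Submodule.add_mem _ hx hy
    | tmul e x =>
      rw [extGZ_tmul]
      refine Submodule.smul_mem _ _ ⟨(show F ⊗[R] T.Cell n from
        (mulRight h n a).comp (toGZ hN hM) x), ?_⟩
      change op (T.ιF h (gz q)) • op (T.ιF h a) • (show F ⊗[R] T.Cell n from toGZ hN hM x) =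
        op (T.ιF h a) • (show F ⊗[R] T.Cell n from toGZ hN hM x)
      rw [← mul_smul, ← MulOpposite.op_mul, ← map_mul, ha.mul_gz]
  · rintro _ ⟨y, rfl⟩
    change op (T.ιF h (gz q)) • y ∈ _
    have hbt : op (T.ιF h (gz t)) • op (T.ιF h b) • y = op (T.ιF h b) • y := by
      rw [← mul_smul, ← MulOpposite.op_mul, ← map_mul, hb.mul_gz]
    obtain ⟨c, z, hc, hz⟩ := exists_smul_eq_one_tmul (op (T.ιF h b) • y)
    have hzero : ∀ x : F ⊗[R] A s, gz t * x = 0 → op (T.ιF h x) • ((1 : F) ⊗ₜ[R] z) = 0 := by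
      intro x hx
      rw [← hz, ← hbt, smul_comm, ← mul_smul (op (T.ιF h x)), ← MulOpposite.op_mul, ← map_mul, hx,
        map_zero, MulOpposite.op_zero, zero_smul, smul_zero]
    -- The vector `y b` lies in the image of F_t, so every z_k with k ≠ l and every F_p with p ≠ t
    -- kills it. Its integral multiple `z` therefore meets the criterion for Δ(n; t) + Δ(n; ▷ l).
    have hmem : z ∈ spanThrough h t n ⊔ spanAbove h l n := by
      refine (mem_spanThrough_sup_iff h ht).mpr ⟨fun k hk => hzero _ ?_, fun p hp => hzero _ ?_⟩
      · rw [← gz_mul_centralIdem, mul_assoc, T.centralIdem_mul_of_ne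
          (by rintro rfl; exact hk le_rfl), mul_zero]
      · exact gz_mul_gz_of_ne hp.symm
    refine ⟨(algebraMap R F c)⁻¹ ⊗ₜ Submodule.Quotient.mk ⟨z, hmem⟩, ?_⟩
    rw [extGZ_tmul]
    -- The scalars cancel and leave y b a, which equals y F_q because the two transports multiply to
    -- F_q.
    change (algebraMap R F c)⁻¹ • op (T.ιF h a) • op (T.ιF h (gz t)) • ((1 : F) ⊗ₜ[R] z) = _
    rw [← hz, smul_comm _ (algebraMap R F c), smul_comm _ (algebraMap R F c), inv_smul_smul₀ hc,
      hbt, ← mul_smul, ← MulOpposite.op_mul, ← map_mul, hb.mul_eq ha]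

theorem skewCellF_equiv (ht : IsMax t) (q : T.Std l) :
    ∃ hQ : IsStable (T.commutantF h) (N := T.CommCellF h n) (cellGZ h q n),
      Nonempty (SkewCellF hN hM ≃ₗ[(T.commutantF h)ᵐᵒᵖ] hQ.sub) := by
  obtain ⟨a, ha⟩ := exists_isTransport t q
  refine ⟨cellGZ_stable h q n, nonempty_equiv_of_range_eq (f := extGZHom hN hM a)
    (extGZ_injective hN hM ht ha) (Submodule.subtype_injective _) ?_⟩
  rw [Submodule.range_subtype]
  ext y
  exact SetLike.ext_iff.mp (range_extGZ hN hM ht ha) y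

end Transport

end DiagramTower

end DiagramAlgebra

theorem mainTheorem4 {R : Type*} {F : Type*} {A : ℕ → Type*} [CommRing R] [IsDomain R] [Field F]
    [Algebra R F] [IsFractionRing R F] [∀ r, Ring (A r)] [∀ r, Algebra R (A r)]
    (T : DiagramTower R F A) {s r : ℕ} (h : s ≤ r) (l : T.Idx s) (n : T.Idx r) :
    (∃ t : T.Std l, IsMax t) ∧
    ∃ (hN : AboveStable h l n) (hM : ∀ t : T.Std l, IsMax t → ThroughStable h n t),
      (∀ (t t' : T.Std l) (ht : IsMax t) (ht' : IsMax t'),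
        Nonempty (SkewCell hN (hM t ht) ≃ₗ[(T.commutant h)ᵐᵒᵖ] SkewCell hN (hM t' ht'))) ∧
      (∀ (t : T.Std l) (ht : IsMax t),
        ∃ hP : IsStable (T.commutant h) (N := Res (T.commToF h) (F ⊗[R] T.Cell n))
            (spanThroughGZ h t n),
          Nonempty (SkewCell hN (hM t ht) ≃ₗ[(T.commutant h)ᵐᵒᵖ] hP.sub)) ∧
      (∀ (t : T.Std l) (ht : IsMax t) (p : T.Std l),
        ∃ hQ : IsStable (T.commutantF h) (N := T.CommCellF h n) (cellGZ h p n),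
          Nonempty (SkewCellF hN (hM t ht) ≃ₗ[(T.commutantF h)ᵐᵒᵖ] hQ.sub)) ∧
      (∀ (t : T.Std l) (ht : IsMax t),
        ∃ b : Module.Basis (T.SkewTab l n) R (SkewCell hN (hM t ht)),
          ∀ p, b p = skewMurphy hN (hM t ht) p) ∧
      (∀ (f : T.Flips) (t t' : T.Std l) (ht : IsMax t) (ht' : IsMax t'),
        Nonempty (Res (f.hom h) (SkewCell hN (hM t ht)) ≃ₗ[(A (r - s))ᵐᵒᵖ]
          Res (f.hom h) (SkewCell hN (hM t' ht')))) := by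
  refine ⟨?_, aboveStable h l n, fun t ht => throughStable h n ht, fun t t' ht ht' => ?_,
    fun t ht => skewCell_equiv_gz _ _ ht, fun t ht p => skewCellF_equiv _ _ ht p,
    fun t ht => exists_basis_skewCell _ _ ht, fun f t t' ht ht' => ?_⟩
  · obtain ⟨t, ht⟩ := Set.finite_univ.exists_maximal (Set.univ_nonempty (α := T.Std l))
    exact ⟨t, fun t' h' => ht.2 trivial h'⟩
  · exact skewCell_equiv _ _ ht _ ht'
  · obtain ⟨e⟩ := skewCell_equiv (aboveStable h l n) (throughStable h n ht) ht
      (throughStable h n ht') ht'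
    exact ⟨Res.congr (f.hom h) e⟩
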